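/- Conventions. All Hilbert spaces are complex and $\otimes$ is the Hilbert space tensor product. An *inclusion system* $E$ is a family of Hilbert spaces $(E_t)_{t>0}$ with isometries $\beta_{s,t}:E_{s+t}\to E_s\otimes E_t$ $(s,t>0)$ such that $(I_r\otimes\beta_{s,t})\beta_{r,s+t}=(\beta_{r,s}\otimes I_t)\beta_{r+s,t}$ for all $r,s,t>0$; it is a *product system* if every $\beta_{s,t}$ is unitary. A *section* of $E$ is a family $(x_t)_{t>0}$ with $x_t\in E_t$. For $T>0$ let $J_T$ be the set of finite sequences ${\bf t}=(t_1,\dots,t_n)$, $n\ge 1$, of strictly positive reals with sum $T$, directed by refinement, and put $E_{\bf t}=E_{t_1}\otimes\cdots\otimes E_{t_n}$. Iterating the structure maps gives isometries $\beta_{{\bf s},{\bf t}}:E_{\bf s}\to E_{\bf t}$ for ${\bf s}\le{\bf t}$, and $\mathcal E_T$ denotes the inductive limit of this system of Hilbert spaces, with canonical isometries $\imath_{\bf t}:E_{\bf t}\to\mathcal E_T$; write $\imath_T=\imath_{(T)}:E_T\to\mathcal E_T$. The *product system generated by* $E$ is $\mathcal E=(\mathcal E_T)_{T>0}$ with the unitary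 structure maps $B_{S,T}:\mathcal E_{S+T}\to\mathcal E_S\otimes\mathcal E_T$ determined by $B_{S,T}\,\imath_{{\bf s}\smile{\bf t}}=\imath_{\bf s}\otimes\imath_{\bf t}$ for ${\bf s}\in J_S$, ${\bf t}\in J_T$, where ${\bf s}\smile{\bf t}$ is the concatenation. A *unit* of an inclusion system $E$ is a nonzero section $u$ such that $u_{s+t}=\beta_{s,t}^*(u_s\otimes u_t)$ for all $s,t>0$ and, for some $k\in\mathbb R$, $e^{-kt}\|u_t\|\le 1$ for all $t>0$; it is *normalised* if $\|u_t\|=1$ for all $t>0$. A *pointed inclusion system* $(E,u)$ is an inclusion system with a normalised unit $u$. An *addit* of $(E,u)$ is a section $a$ of $E$ such that $$a_{s+t}=\beta_{s,t}^*(a_s\otimes u_t+u_s\otimes a_t)\qquad(s,t>0)$$ and, for some $k\ge 0$, $\|a_t\|^2\le k(t+t^2)$ for all $t>0$; it is a *root* if moreover $a_t\perp u_t$ for all $t>0$. These notions apply in particular to the inclusion system $\mathcal E$. **Proposition 3.12.** Let $(E,u)$ be a pointed inclusion system and let $\mathcal E$ be the product system generated by $E$. There is exactly one unit $\widehat u$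 of $\mathcal E$ with $\imath_t^*\widehat u_t=u_t$ for all $t>0$ (the *lift* of $u$), and $\widehat u$ is normalised. Moreover: (a) The map $(b_t)_{t>0}\mapsto(\imath_t^*b_t)_{t>0}$ restricts to a bijection from the set of addits of $(\mathcal E,\widehat u)$ onto the set of addits of $(E,u)$. Its inverse is denoted by $a\mapsto\widehat a$. (b) If $a$ is a root of $(E,u)$, then $\widehat a$ is a root of $(\mathcal E,\widehat u)$. -/

import Mathlib

open UniformSpace
open scoped TensorProduct InnerProductSpace

universe w

noncomputable section

/-! ### Hilbert space tensor products -/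

section Tensor

/-- The Hilbert space tensor product: the completion of the algebraic tensor product with respect
to the inner product determined by `⟪x ⊗ y, x' ⊗ y'⟫ = ⟪x, x'⟫ * ⟪y, y'⟫`. -/
def HTensor (E F : Type*) [NormedAddCommGroup E] [InnerProductSpace ℂ E]
    [NormedAddCommGroup F] [InnerProductSpace ℂ F] : Type _ :=
  Completion (E ⊗[ℂ] F)

section Instances

variable (E F : Type*) [NormedAddCommGroup E] [InnerProductSpace ℂ E]
  [NormedAddCommGroup F] [InnerProductSpace ℂ F]

instance : NormedAddCommGroup (HTensor E F) :=
  inferInstanceAs (NormedAddCommGroup (Completion (E ⊗[ℂ] F)))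
instance : InnerProductSpace ℂ (HTensor E F) :=
  inferInstanceAs (InnerProductSpace ℂ (Completion (E ⊗[ℂ] F)))
instance : CompleteSpace (HTensor E F) :=
  inferInstanceAs (CompleteSpace (Completion (E ⊗[ℂ] F)))

end Instances

variable {V E F G H E' F' K : Type*}
  [NormedAddCommGroup V] [InnerProductSpace ℂ V]
  [NormedAddCommGroup E] [InnerProductSpace ℂ E]
  [NormedAddCommGroup F] [InnerProductSpace ℂ F]
  [NormedAddCommGroup G] [InnerProductSpace ℂ G]
  [NormedAddCommGroup H] [InnerProductSpace ℂ H]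
  [NormedAddCommGroup E'] [InnerProductSpace ℂ E']
  [NormedAddCommGroup F'] [InnerProductSpace ℂ F']
  [NormedAddCommGroup K] [InnerProductSpace ℂ K]

/-- Elementary tensors `x ⊗ y`, as a continuous bilinear map. -/
def htmul : E →L[ℂ] F →L[ℂ] HTensor E F :=
  (ContinuousLinearMap.compL ℂ F (E ⊗[ℂ] F) (HTensor E F) Completion.toComplL).comp
    (TensorProduct.mkL ℂ E F)

/-- A bilinear map which respects inner products in the same way as the tensor product. -/
def InnerMul (b : E →ₗ[ℂ] F →L[ℂ] G) : Prop :=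
  ∀ x x' y y', ⟪b x y, b x' y'⟫_ℂ = ⟪x, x'⟫_ℂ * ⟪y, y'⟫_ℂ

theorem htmul_apply (x : E) (y : F) :
    htmul x y = ((x ⊗ₜ[ℂ] y : E ⊗[ℂ] F) : Completion (E ⊗[ℂ] F)) := rfl

theorem innerMul_htmul : InnerMul (htmul : E →L[ℂ] F →L[ℂ] HTensor E F).toLinearMap := by
  intro x x' y y'
  exact (Completion.inner_coe _ _).trans (TensorProduct.inner_tmul ℂ x x' y y')

theorem InnerMul.norm {b : E →ₗ[ℂ] F →L[ℂ] G} (hb : InnerMul b) (x : E) (y : F) :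
    ‖b x y‖ = ‖x‖ * ‖y‖ := by
  have h : ‖b x y‖ ^ 2 = (‖x‖ * ‖y‖) ^ 2 := by
    have h1 := hb x x y y
    simp only [inner_self_eq_norm_sq_to_K] at h1
    rw [mul_pow]
    exact_mod_cast h1
  exact (sq_eq_sq₀ (norm_nonneg _) (by positivity)).1 h

theorem InnerMul.opNorm_le {b : E →ₗ[ℂ] F →L[ℂ] G} (hb : InnerMul b) (x : E) :
    ‖b x‖ ≤ 1 * ‖x‖ := by
  rw [one_mul]
  exact ContinuousLinearMap.opNorm_le_bound _ (norm_nonneg _) fun y => (hb.norm x y).le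

variable {Z : Type*} [NormedAddCommGroup Z] [NormedSpace ℂ Z]

/-- Two continuous linear maps on a completion agree if they agree on the original space. -/
theorem completion_ext {f g : Completion V →L[ℂ] Z} (h : ∀ x : V, f x = g x) : f = g := by
  ext x
  induction x using Completion.induction_on with
  | hp => exact isClosed_eq f.continuous g.continuous
  | ih x => exact h x

theorem htensor_ext_aux {f g : Completion (E ⊗[ℂ] F) →L[ℂ] Z}
    (h : ∀ (x : E) (y : F), f ((x ⊗ₜ[ℂ] y : E ⊗[ℂ] F)) = g ((x ⊗ₜ[ℂ] y : E ⊗[ℂ] F))) :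
    f = g := by
  refine completion_ext fun z => ?_
  induction z using TensorProduct.induction_on with
  | zero => exact (map_zero f).trans (map_zero g).symm
  | tmul x y => exact h x y
  | add a b ha hb => simp only [Completion.coe_add, map_add, ha, hb]

/-- Two continuous linear maps agree if they agree on elementary tensors. -/
theorem htensor_ext {f g : HTensor E F →L[ℂ] Z} (h : ∀ x y, f (htmul x y) = g (htmul x y)) :
    f = g :=
  htensor_ext_aux h

/-- Extension to the completion of a bilinear map respecting inner products. -/
def biExtend [CompleteSpace H] (b : V →ₗ[ℂ] F →L[ℂ] H) (hb : InnerMul b) :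
    Completion V →L[ℂ] F →L[ℂ] H :=
  (b.mkContinuous 1 hb.opNorm_le).fromCompletion

theorem biExtend_coe [CompleteSpace H] (b : V →ₗ[ℂ] F →L[ℂ] H) (hb : InnerMul b) (x : V) :
    biExtend b hb x = b x := by
  simp [biExtend]

theorem innerMul_biExtend [CompleteSpace H] (b : V →ₗ[ℂ] F →L[ℂ] H) (hb : InnerMul b) :
    InnerMul (biExtend b hb).toLinearMap := by
  intro x x' y y'
  induction x, x' using Completion.induction_on₂ with
  | hp => exact isClosed_eq (by simp only [ContinuousLinearMap.coe_coe]; fun_prop) (by fun_prop)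
  | ih x x' =>
    simp only [ContinuousLinearMap.coe_coe, biExtend_coe, Completion.inner_coe]
    exact hb x x' y y'

/-- Extension of an isometry to the completion. -/
def isoExtend [CompleteSpace H] (f : V →ₗᵢ[ℂ] H) : Completion V →ₗᵢ[ℂ] H where
  toLinearMap := f.toContinuousLinearMap.fromCompletion.toLinearMap
  norm_map' x := by
    induction x using Completion.induction_on with
    | hp => exact isClosed_eq (by simp only [ContinuousLinearMap.coe_coe]; fun_prop) (by fun_prop)
    | ih x => simp

theorem isoExtend_coe [CompleteSpace H] (f : V →ₗᵢ[ℂ] H) (x : V) :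
    isoExtend f (x : Completion V) = f x := by
  change f.toContinuousLinearMap.fromCompletion (x : Completion V) = f x
  simp

/-- The isometry `x ⊗ y ↦ b x y` on the Hilbert space tensor product. -/
def hlift [CompleteSpace G] (b : E →L[ℂ] F →L[ℂ] G) (hb : InnerMul b.toLinearMap) :
    HTensor E F →ₗᵢ[ℂ] G :=
  isoExtend <| LinearMap.isometryOfInner
    (TensorProduct.lift ((ContinuousLinearMap.coeLM ℂ).comp b.toLinearMap)) <| by
      intro x y
      induction x using TensorProduct.induction_on with
      | zero => simp
      | add x₁ x₂ h₁ h₂ => simp only [map_add, inner_add_left, h₁, h₂]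
      | tmul x x' =>
        induction y using TensorProduct.induction_on with
        | zero => simp
        | add y₁ y₂ h₁ h₂ => simp only [map_add, inner_add_right, h₁, h₂]
        | tmul y y' => exact hb x y x' y'

@[simp]
theorem hlift_htmul [CompleteSpace G] (b : E →L[ℂ] F →L[ℂ] G) (hb : InnerMul b.toLinearMap)
    (x : E) (y : F) : hlift b hb (htmul x y) = b x y := by
  exact isoExtend_coe _ _

theorem InnerMul.bilinearComp {b : E →L[ℂ] F →L[ℂ] G} (hb : InnerMul b.toLinearMap)
    (f : E' →ₗᵢ[ℂ] E) (g : F' →ₗᵢ[ℂ] F) :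
    InnerMul (b.bilinearComp f.toContinuousLinearMap g.toContinuousLinearMap).toLinearMap := by
  intro x x' y y'
  simpa using hb (f x) (f x') (g y) (g y')

theorem InnerMul.flip {b : E →L[ℂ] F →L[ℂ] G} (hb : InnerMul b.toLinearMap) :
    InnerMul b.flip.toLinearMap := by
  intro x x' y y'
  simpa [mul_comm] using hb y y' x x'

/-- The tensor product `f ⊗ g` of two isometries. -/
def hmap (f : E →ₗᵢ[ℂ] E') (g : F →ₗᵢ[ℂ] F') : HTensor E F →ₗᵢ[ℂ] HTensor E' F' :=
  hlift (htmul.bilinearComp f.toContinuousLinearMap g.toContinuousLinearMap)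
    (innerMul_htmul.bilinearComp f g)

@[simp]
theorem hmap_htmul (f : E →ₗᵢ[ℂ] E') (g : F →ₗᵢ[ℂ] F') (x : E) (y : F) :
    hmap f g (htmul x y) = htmul (f x) (g y) := by
  simp [hmap]

/-- The algebraic part of `biComp`. -/
def biCompAux (b : E →L[ℂ] G →L[ℂ] H) (d : F →L[ℂ] K →L[ℂ] G) :
    E ⊗[ℂ] F →ₗ[ℂ] K →L[ℂ] H :=
  TensorProduct.lift <| LinearMap.mk₂ ℂ (fun x y => (b x).comp (d y))
    (fun x x' y => by ext; simp) (fun c x y => by ext; simp)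
    (fun x y y' => by ext; simp) (fun c x y => by ext; simp)

theorem innerMul_biCompAux {b : E →L[ℂ] G →L[ℂ] H} (hb : InnerMul b.toLinearMap)
    {d : F →L[ℂ] K →L[ℂ] G} (hd : InnerMul d.toLinearMap) : InnerMul (biCompAux b d) := by
  intro x x' y y'
  induction x using TensorProduct.induction_on with
  | zero => simp
  | add x₁ x₂ h₁ h₂ =>
    simp only [map_add, inner_add_left, add_apply, h₁, h₂, add_mul]
  | tmul u v =>
    induction x' using TensorProduct.induction_on with
    | zero => simp
    | add x₁ x₂ h₁ h₂ =>
      simp only [map_add, inner_add_right, add_apply, h₁, h₂, add_mul]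
    | tmul u' v' =>
      have h1 := hb u u' (d v y) (d v' y')
      have h2 := hd v v' y y'
      simp only [ContinuousLinearMap.coe_coe] at h1 h2
      simp [biCompAux, h1, h2, mul_assoc]

/-- The bilinear map with `(x ⊗ y, z) ↦ b x (d y z)`. -/
def biComp [CompleteSpace H] (b : E →L[ℂ] G →L[ℂ] H) (hb : InnerMul b.toLinearMap)
    (d : F →L[ℂ] K →L[ℂ] G) (hd : InnerMul d.toLinearMap) :
    HTensor E F →L[ℂ] K →L[ℂ] H :=
  biExtend (biCompAux b d) (innerMul_biCompAux hb hd)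

theorem innerMul_biComp [CompleteSpace H] (b : E →L[ℂ] G →L[ℂ] H) (hb : InnerMul b.toLinearMap)
    (d : F →L[ℂ] K →L[ℂ] G) (hd : InnerMul d.toLinearMap) :
    InnerMul (biComp b hb d hd).toLinearMap :=
  innerMul_biExtend _ _

@[simp]
theorem biComp_htmul [CompleteSpace H] (b : E →L[ℂ] G →L[ℂ] H) (hb : InnerMul b.toLinearMap)
    (d : F →L[ℂ] K →L[ℂ] G) (hd : InnerMul d.toLinearMap) (x : E) (y : F) (z : K) :
    biComp b hb d hd (htmul x y) z = b x (d y z) := by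
  exact DFunLike.congr_fun (biExtend_coe (biCompAux b d) (innerMul_biCompAux hb hd) (x ⊗ₜ y)) z

/-- The associativity isometry `(x ⊗ y) ⊗ z ↦ x ⊗ (y ⊗ z)`. -/
def hassoc : HTensor (HTensor E F) G →ₗᵢ[ℂ] HTensor E (HTensor F G) :=
  hlift (biComp htmul innerMul_htmul htmul innerMul_htmul) (innerMul_biComp _ _ _ _)

@[simp]
theorem hassoc_htmul (x : E) (y : F) (z : G) :
    hassoc (htmul (htmul x y) z) = htmul x (htmul y z) := by
  simp [hassoc]

/-- Two isometries agree if they agree on elementary tensors. -/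
theorem htensor_iso_ext {f g : HTensor E F →ₗᵢ[ℂ] K} (h : ∀ x y, f (htmul x y) = g (htmul x y)) :
    f = g := by
  have := htensor_ext (f := f.toContinuousLinearMap) (g := g.toContinuousLinearMap) h
  ext x
  exact DFunLike.congr_fun this x

theorem htensor_iso_ext₃ {f g : HTensor (HTensor E F) G →ₗᵢ[ℂ] K}
    (h : ∀ x y z, f (htmul (htmul x y) z) = g (htmul (htmul x y) z)) : f = g := by
  refine htensor_iso_ext fun w z => ?_
  have := htensor_ext (f := f.toContinuousLinearMap.comp (htmul.flip z))
    (g := g.toContinuousLinearMap.comp (htmul.flip z)) (fun x y => h x y z)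
  exact DFunLike.congr_fun this w

end Tensor

/-! ### Inductive limits of Hilbert spaces -/

section IndLim

variable {ι : Type*} [Preorder ι] [IsDirectedOrder ι] [Nonempty ι] {G : ι → Type*}
  [∀ i, NormedAddCommGroup (G i)] [∀ i, InnerProductSpace ℂ (G i)]
  (f : ∀ i j, i ≤ j → G i →ₗᵢ[ℂ] G j) [DirectedSystem G (f · · ·)]

/-- The algebraic inductive limit of a directed system of Hilbert spaces and isometries: the
quotient of the disjoint union of the spaces `G i` which identifies `x` with `f i j _ x`. -/
def PreLim : Type _ := DirectLimit G f

instance : AddCommGroup (PreLim f) := inferInstanceAs (AddCommGroup (DirectLimit G f))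
instance : Module ℂ (PreLim f) := inferInstanceAs (Module ℂ (DirectLimit G f))

/-- The canonical maps into the algebraic inductive limit. -/
def preOf (i : ι) : G i →ₗ[ℂ] PreLim f := DirectLimit.Module.of ℂ ι G f i

theorem preOf_map (i j : ι) (h : i ≤ j) (x : G i) : preOf f j (f i j h x) = preOf f i x :=
  (DirectLimit.eq_of_le (f := f) ⟨i, x⟩ j h).symm

theorem exists_preOf (z : PreLim f) : ∃ i x, z = preOf f i x :=
  DirectLimit.exists_eq_mk f z

theorem exists_preOf₂ (z w : PreLim f) : ∃ i x y, z = preOf f i x ∧ w = preOf f i y :=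
  DirectLimit.exists_eq_mk₂ f z w

theorem exists_preOf₃ (z w v : PreLim f) :
    ∃ i x y t, z = preOf f i x ∧ w = preOf f i y ∧ v = preOf f i t :=
  DirectLimit.exists_eq_mk₃ f z w v

/-- The inner product on the algebraic inductive limit: `⟪preOf i x, preOf i y⟫ = ⟪x, y⟫`. -/
def preInner : PreLim f → PreLim f → ℂ :=
  DirectLimit.lift₂ f f (fun _ x y => ⟪x, y⟫_ℂ)
    (fun i j h x y => ((f i j h).inner_map_map x y).symm)

theorem preInner_preOf (i : ι) (x y : G i) : preInner f (preOf f i x) (preOf f i y) = ⟪x, y⟫_ℂ :=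
  DirectLimit.lift₂_def f f (fun _ x y => ⟪x, y⟫_ℂ)
    (fun i j h x y => ((f i j h).inner_map_map x y).symm) i x y

/-- The inner product space structure of the algebraic inductive limit. -/
abbrev preLimCore : InnerProductSpace.Core ℂ (PreLim f) where
  inner := preInner f
  conj_inner_symm z w := by
    obtain ⟨i, x, y, rfl, rfl⟩ := exists_preOf₂ f z w
    simp only [preInner_preOf, inner_conj_symm]
  re_inner_nonneg z := by
    obtain ⟨i, x, rfl⟩ := exists_preOf f z
    simp only [preInner_preOf]
    exact inner_self_nonneg
  add_left z w v := by
    obtain ⟨i, x, y, t, rfl, rfl, rfl⟩ := exists_preOf₃ f z w v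
    simp only [← map_add, preInner_preOf, inner_add_left]
  smul_left z w c := by
    obtain ⟨i, x, y, rfl, rfl⟩ := exists_preOf₂ f z w
    simp only [← map_smul, preInner_preOf, inner_smul_left]
  definite z h := by
    obtain ⟨i, x, rfl⟩ := exists_preOf f z
    rw [preInner_preOf, inner_self_eq_zero] at h
    rw [h, map_zero]

instance : NormedAddCommGroup (PreLim f) := (preLimCore f).toNormedAddCommGroup
instance : InnerProductSpace ℂ (PreLim f) := .ofCore (preLimCore f).toCore

theorem inner_preOf (i : ι) (x y : G i) : ⟪preOf f i x, preOf f i y⟫_ℂ = ⟪x, y⟫_ℂ :=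
  preInner_preOf f i x y

/-- The inductive limit of a directed system of Hilbert spaces and isometries: the completion of
the algebraic inductive limit. -/
abbrev IndLim : Type _ := Completion (PreLim f)

/-- The canonical isometries into the inductive limit. -/
def limOf (i : ι) : G i →ₗᵢ[ℂ] IndLim f :=
  (Completion.toComplₗᵢ (𝕜 := ℂ) (E := PreLim f)).comp
    ((preOf f i).isometryOfInner (inner_preOf f i))

theorem limOf_apply (i : ι) (x : G i) : limOf f i x = ((preOf f i x : PreLim f) : IndLim f) := rfl

theorem limOf_map (i j : ι) (h : i ≤ j) (x : G i) : limOf f j (f i j h x) = limOf f i x := by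
  rw [limOf_apply, limOf_apply, preOf_map]

variable {F K : Type*} [NormedAddCommGroup F] [InnerProductSpace ℂ F]
  [NormedAddCommGroup K] [InnerProductSpace ℂ K]

theorem indLim_ext {f} [DirectedSystem G (f · · ·)] {g h : IndLim f →L[ℂ] F}
    (H : ∀ i x, g (limOf f i x) = h (limOf f i x)) : g = h := by
  refine completion_ext fun z => ?_
  obtain ⟨i, x, rfl⟩ := exists_preOf f z
  exact H i x

section Bi

variable (b : ∀ i, G i →L[ℂ] F →L[ℂ] K)
  (hc : ∀ i j h x, b j (f i j h x) = b i x)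

/-- The algebraic part of `limBi`. -/
def limBiAux : PreLim f →ₗ[ℂ] F →L[ℂ] K :=
  DirectLimit.Module.lift ℂ ι G f (fun i => (b i).toLinearMap) hc

theorem limBiAux_preOf (i : ι) (x : G i) : limBiAux f b hc (preOf f i x) = b i x := rfl

theorem innerMul_limBiAux (hb : ∀ i, InnerMul (b i).toLinearMap) : InnerMul (limBiAux f b hc) := by
  intro z w y y'
  obtain ⟨i, x, x', rfl, rfl⟩ := exists_preOf₂ f z w
  rw [limBiAux_preOf, limBiAux_preOf, inner_preOf]
  exact hb i x x' y y'

variable [CompleteSpace K]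

/-- The bilinear map on the inductive limit induced by a compatible family of bilinear maps which
respect inner products. -/
def limBi (hb : ∀ i, InnerMul (b i).toLinearMap) : IndLim f →L[ℂ] F →L[ℂ] K :=
  biExtend (limBiAux f b hc) (innerMul_limBiAux f b hc hb)

theorem innerMul_limBi (hb : ∀ i, InnerMul (b i).toLinearMap) : InnerMul (limBi f b hc hb).toLinearMap := innerMul_biExtend _ _

theorem limBi_limOf (hb : ∀ i, InnerMul (b i).toLinearMap) (i : ι) (x : G i) : limBi f b hc hb (limOf f i x) = b i x := by
  rw [limBi, limOf_apply, biExtend_coe, limBiAux_preOf]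

end Bi

end IndLim

/-! ### Inclusion systems -/

/-- The parameter set: the strictly positive reals. -/
abbrev PosReal : Type := {t : ℝ // 0 < t}

/-- An inclusion system: Hilbert spaces `fib t` for `t > 0` with isometric structure maps
`β s t : fib (s + t) → fib s ⊗ fib t` which are coassociative. The equation `s + t = r` is passed
as an argument, so that `β` starts at `fib r` and both sides of the coassociativity condition
`(I ⊗ β s t) (β r (s + t)) = (β r s ⊗ I) (β (r + s) t)` start at the same space. -/
structure InclusionSystem where
  fib : PosReal → Type w
  [normed : ∀ t, NormedAddCommGroup (fib t)]
  [inner : ∀ t, InnerProductSpace ℂ (fib t)]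
  [complete : ∀ t, CompleteSpace (fib t)]
  β : ∀ {s t r : PosReal}, s + t = r → fib r →ₗᵢ[ℂ] HTensor (fib s) (fib t)
  coassoc : ∀ {r s t rs st rst : PosReal} (h₁ : s + t = st) (h₂ : r + st = rst)
    (h₃ : r + s = rs) (h₄ : rs + t = rst) (x : fib rst),
    hmap .id (β h₁) (β h₂ x) = hassoc (hmap (β h₃) .id (β h₄ x))

attribute [instance] InclusionSystem.normed InclusionSystem.inner InclusionSystem.complete

/-- Nonempty finite sequences `(t₁, …, tₙ)` of strictly positive reals. -/
inductive PosSeq : Type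
  | one (t : PosReal) : PosSeq
  | cons (t : PosReal) (c : PosSeq) : PosSeq

/-- The sum `t₁ + ⋯ + tₙ`. -/
def PosSeq.total : PosSeq → PosReal
  | .one t => t
  | .cons t c => t + c.total

/-- `Ref c d` says that `d` refines `c`, that is, `d` is a concatenation `c₁ ⌣ ⋯ ⌣ cₘ` where `cᵢ`
has sum equal to the `i`-th entry of `c`. The sequence `d` is read from the left: its first entry
either equals the first entry of `c`, or is smaller and is split off from it. -/
inductive Ref : PosSeq → PosSeq → Type
  | refl (t : PosReal) : Ref (.one t) (.one t)
  | keep (t : PosReal) {c d : PosSeq} : Ref c d → Ref (.cons t c) (.cons t d)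
  | splitOne {s t r : PosReal} {d : PosSeq} (h : s + t = r) :
      Ref (.one t) d → Ref (.one r) (.cons s d)
  | splitCons {s t r : PosReal} {c d : PosSeq} (h : s + t = r) :
      Ref (.cons t c) d → Ref (.cons r c) (.cons s d)

namespace Ref

theorem total_eq {c d : PosSeq} (h : Ref c d) : c.total = d.total := by
  induction h with
  | refl t => rfl
  | keep t h ih => simp [PosSeq.total, ih]
  | splitOne h _ ih => rw [← h]; simp [PosSeq.total, ← ih]
  | splitCons h _ ih => rw [← h]; simp [PosSeq.total, ← ih, add_assoc]

theorem pos_add_ne {s t : PosReal} : s + t ≠ s := by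
  intro h
  have h1 := congrArg Subtype.val h
  change (s : ℝ) + t = s at h1
  linarith [t.2]

theorem pos_add_cancel {s t t' : PosReal} (h : s + t = s + t') : t = t' := by
  have h1 := congrArg Subtype.val h
  change (s : ℝ) + t = s + t' at h1
  exact Subtype.ext (by linarith)

instance subsingleton : (c d : PosSeq) → Subsingleton (Ref c d) := fun c d => ⟨fun a b => by
  induction a with
  | refl t => cases b; rfl
  | keep t h ih =>
    cases b with
    | keep t h' => rw [ih h']
    | splitCons h _ => exact absurd h pos_add_ne
  | splitOne h a ih =>
    cases b with
    | splitOne h' b =>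
      subst h
      obtain rfl := pos_add_cancel h'
      rw [ih b]
  | splitCons h a ih =>
    cases b with
    | keep t h' => exact absurd h pos_add_ne
    | splitCons h' b =>
      subst h
      obtain rfl := pos_add_cancel h'
      rw [ih b]⟩

/-- Every sequence refines itself. -/
def rfl' : (c : PosSeq) → Ref c c
  | .one t => .refl t
  | .cons t c => .keep t (rfl' c)

/-- Refinement is transitive. -/
def trans : {a b c : PosSeq} → Ref a b → Ref b c → Ref a c
  | _, _, _, h, .refl _ => h
  | _, _, _, .keep t h, .keep _ h' => .keep t (h.trans h')
  | _, _, _, .splitOne e h, .keep _ h' => .splitOne e (h.trans h')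
  | _, _, _, .splitCons e h, .keep _ h' => .splitCons e (h.trans h')
  | _, _, _, .refl _, .splitOne e h' => .splitOne e h'
  | _, _, _, .keep _ h, .splitCons e h' => .splitCons e (trans (.keep _ h) h')
  | _, _, _, .splitOne e h, .splitCons (s := s) (t := t) e' h' =>
      .splitOne (s := s) (t := t + _) (by rw [← e, ← e', add_assoc]) (trans (.splitOne rfl h) h')
  | _, _, _, .splitCons e h, .splitCons (s := s) (t := t) e' h' =>
      .splitCons (s := s) (t := t + _) (by rw [← e, ← e', add_assoc]) (trans (.splitCons rfl h) h')

end Ref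

/-- The set `J_T` of finite sequences of strictly positive reals with sum `T`. -/
abbrev Subdiv (T : PosReal) : Type := {c : PosSeq // c.total = T}

/-- `J_T` is ordered by refinement. -/
instance (T : PosReal) : Preorder (Subdiv T) where
  le c d := Nonempty (Ref c.1 d.1)
  le_refl c := ⟨Ref.rfl' c.1⟩
  le_trans _ _ _ h h' := ⟨h.some.trans h'.some⟩

/-- The one-term sequence `(T)`. -/
def Subdiv.single (T : PosReal) : Subdiv T := ⟨.one T, rfl⟩

instance (T : PosReal) : Nonempty (Subdiv T) := ⟨Subdiv.single T⟩

theorem PosReal.trichotomy (s t : PosReal) :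
    s = t ∨ (∃ r, s + r = t) ∨ ∃ r, t + r = s := by
  rcases lt_trichotomy (s : ℝ) t with h | h | h
  · exact .inr (.inl ⟨⟨t - s, sub_pos.2 h⟩, Subtype.ext (add_sub_cancel _ _)⟩)
  · exact .inl (Subtype.ext h)
  · exact .inr (.inr ⟨⟨s - t, sub_pos.2 h⟩, Subtype.ext (add_sub_cancel _ _)⟩)

theorem PosSeq.total_cons {a S T : PosReal} (h : a + S = T) {c : PosSeq} (hc : c.total = S) :
    (PosSeq.cons a c).total = T := by
  rw [← h, ← hc, PosSeq.total]

/-- Every sequence with sum `T` refines `(T)`. -/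
theorem Ref.nonempty_one : (c : PosSeq) → (T : PosReal) → c.total = T → Nonempty (Ref (.one T) c)
  | .one t, T, h => by
    obtain rfl : t = T := h
    exact ⟨.refl t⟩
  | .cons t c, T, h => ⟨.splitOne h (nonempty_one c _ rfl).some⟩

/-- The number of terms. -/
def PosSeq.len : PosSeq → ℕ
  | .one _ => 1
  | .cons _ c => c.len + 1

/-- Any two sequences with the same sum have a common refinement. -/
theorem Ref.exists_common : (n : ℕ) → (c d : PosSeq) → c.len + d.len ≤ n → c.total = d.total →
    ∃ e, Nonempty (Ref c e) ∧ Nonempty (Ref d e)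
  | 0, c, d, hn, _ => by cases c <;> simp [PosSeq.len] at hn
  | n + 1, .one t, d, _, h => ⟨d, nonempty_one d t h.symm, ⟨rfl' d⟩⟩
  | n + 1, .cons s c, .one t, _, h => ⟨.cons s c, ⟨rfl' _⟩, nonempty_one _ t h⟩
  | n + 1, .cons s c, .cons t d, hn, h => by
    simp only [PosSeq.len, PosSeq.total] at hn h
    rcases PosReal.trichotomy s t with rfl | ⟨r, rfl⟩ | ⟨r, rfl⟩
    · obtain ⟨e, ⟨h₁⟩, ⟨h₂⟩⟩ := exists_common n c d (by omega) (pos_add_cancel h)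
      exact ⟨.cons s e, ⟨.keep s h₁⟩, ⟨.keep s h₂⟩⟩
    · obtain ⟨e, ⟨h₁⟩, ⟨h₂⟩⟩ := exists_common n c (.cons r d) (by simp only [PosSeq.len]; omega)
        (pos_add_cancel (s := s) (by rw [h, PosSeq.total, add_assoc]))
      exact ⟨.cons s e, ⟨.keep s h₁⟩, ⟨.splitCons rfl h₂⟩⟩
    · obtain ⟨e, ⟨h₁⟩, ⟨h₂⟩⟩ := exists_common n (.cons r c) d (by simp only [PosSeq.len]; omega)
        (pos_add_cancel (s := t) (by rw [← h, PosSeq.total, add_assoc]))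
      exact ⟨.cons t e, ⟨.splitCons rfl h₁⟩, ⟨.keep t h₂⟩⟩

instance (T : PosReal) : IsDirectedOrder (Subdiv T) where
  directed c d := by
    obtain ⟨e, ⟨h₁⟩, ⟨h₂⟩⟩ := Ref.exists_common _ c.1 d.1 le_rfl (c.2.trans d.2.symm)
    exact ⟨⟨e, h₁.total_eq.symm.trans c.2⟩, ⟨h₁⟩, ⟨h₂⟩⟩

/-- A bundled Hilbert space. -/
structure BundledHilbert where
  carrier : Type w
  [normed : NormedAddCommGroup carrier]
  [inner : InnerProductSpace ℂ carrier]
  [complete : CompleteSpace carrier]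

attribute [instance] BundledHilbert.normed BundledHilbert.inner BundledHilbert.complete

namespace InclusionSystem

variable (E : InclusionSystem.{w})

/-- The Hilbert space `E_t₁ ⊗ (E_t₂ ⊗ (⋯ ⊗ E_tₙ))` of a sequence `(t₁, …, tₙ)`. -/
def tensBundled : PosSeq → BundledHilbert.{w}
  | .one t => ⟨E.fib t⟩
  | .cons t c => ⟨HTensor (E.fib t) (tensBundled c).carrier⟩

/-- The Hilbert space `E_t₁ ⊗ ⋯ ⊗ E_tₙ` of a sequence `(t₁, …, tₙ)`. -/
def Tens (c : PosSeq) : Type w := (E.tensBundled c).carrier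

instance (c : PosSeq) : NormedAddCommGroup (E.Tens c) := (E.tensBundled c).normed
instance (c : PosSeq) : InnerProductSpace ℂ (E.Tens c) := (E.tensBundled c).inner
instance (c : PosSeq) : CompleteSpace (E.Tens c) := (E.tensBundled c).complete

/-- The identification of the Hilbert space of `(t)` with `E_t`. -/
def oneIso (t : PosReal) : E.Tens (.one t) ≃ₗᵢ[ℂ] E.fib t := .refl ℂ _

/-- The identification of the Hilbert space of `(t, t₁, …, tₙ)` with `E_t ⊗ (E_t₁ ⊗ ⋯ ⊗ E_tₙ)`. -/
def consIso (t : PosReal) (c : PosSeq) :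
    E.Tens (.cons t c) ≃ₗᵢ[ℂ] HTensor (E.fib t) (E.Tens c) := .refl ℂ _

/-- The isometry `E_c → E_d` of a refinement `d` of `c`. -/
def refMap : {c d : PosSeq} → Ref c d → E.Tens c →ₗᵢ[ℂ] E.Tens d
  | _, _, .refl _ => .id
  | _, _, .keep t (c := c) (d := d) h =>
    (E.consIso t d).symm.toLinearIsometry.comp
      ((hmap .id (refMap h)).comp (E.consIso t c).toLinearIsometry)
  | _, _, .splitOne (s := s) (t := t) (r := r) (d := d) e h =>
    (E.consIso s d).symm.toLinearIsometry.comp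
      ((hmap .id ((refMap h).comp (E.oneIso t).symm.toLinearIsometry)).comp
        ((E.β e).comp (E.oneIso r).toLinearIsometry))
  | _, _, .splitCons (s := s) (t := t) (r := r) (c := c) (d := d) e h =>
    (E.consIso s d).symm.toLinearIsometry.comp
      ((hmap .id ((refMap h).comp (E.consIso t c).symm.toLinearIsometry)).comp
        (hassoc.comp ((hmap (E.β e) .id).comp (E.consIso r c).toLinearIsometry)))

end InclusionSystem

section TensorIdentities

variable {A B C D A' B' C' A'' B'' : Type*}
  [NormedAddCommGroup A] [InnerProductSpace ℂ A]
  [NormedAddCommGroup B] [InnerProductSpace ℂ B]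
  [NormedAddCommGroup C] [InnerProductSpace ℂ C]
  [NormedAddCommGroup D] [InnerProductSpace ℂ D]
  [NormedAddCommGroup A'] [InnerProductSpace ℂ A']
  [NormedAddCommGroup B'] [InnerProductSpace ℂ B']
  [NormedAddCommGroup C'] [InnerProductSpace ℂ C']
  [NormedAddCommGroup A''] [InnerProductSpace ℂ A'']
  [NormedAddCommGroup B''] [InnerProductSpace ℂ B'']

theorem hmap_hmap (f' : A' →ₗᵢ[ℂ] A'') (f : A →ₗᵢ[ℂ] A') (g' : B' →ₗᵢ[ℂ] B'')
    (g : B →ₗᵢ[ℂ] B') (x : HTensor A B) :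
    hmap f' g' (hmap f g x) = hmap (f'.comp f) (g'.comp g) x := by
  refine DFunLike.congr_fun (f := (hmap f' g').comp (hmap f g)) (htensor_iso_ext fun x y => ?_) x
  simp

theorem hmap_id (x : HTensor A B) : hmap (.id : A →ₗᵢ[ℂ] A) (.id : B →ₗᵢ[ℂ] B) x = x := by
  refine DFunLike.congr_fun (g := LinearIsometry.id) (htensor_iso_ext fun x y => ?_) x
  simp

theorem hassoc_hmap (f : A →ₗᵢ[ℂ] A') (g : B →ₗᵢ[ℂ] B') (h : C →ₗᵢ[ℂ] C')
    (x : HTensor (HTensor A B) C) :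
    hassoc (hmap (hmap f g) h x) = hmap f (hmap g h) (hassoc x) := by
  refine DFunLike.congr_fun (f := hassoc.comp (hmap (hmap f g) h))
    (g := (hmap f (hmap g h)).comp hassoc) (htensor_iso_ext₃ fun x y z => ?_) x
  simp

theorem hassoc_pentagon (x : HTensor (HTensor (HTensor A B) C) D) :
    hmap .id hassoc (hassoc (hmap hassoc .id x)) = hassoc (hassoc x) := by
  refine DFunLike.congr_fun (f := (hmap .id hassoc).comp (hassoc.comp (hmap hassoc .id)))
    (g := hassoc.comp hassoc) (htensor_iso_ext₃ fun v y z => ?_) x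
  let f : HTensor (HTensor (HTensor A B) C) D →ₗᵢ[ℂ] _ :=
    (hmap .id hassoc).comp (hassoc.comp (hmap hassoc .id))
  let g : HTensor (HTensor (HTensor A B) C) D →ₗᵢ[ℂ] _ := hassoc.comp hassoc
  have := htensor_ext
    (f := f.toContinuousLinearMap.comp ((htmul.flip z).comp (htmul.flip y)))
    (g := g.toContinuousLinearMap.comp ((htmul.flip z).comp (htmul.flip y)))
    (fun a b => by simp [f, g])
  exact DFunLike.congr_fun this v

theorem hassoc_slide (f : A' →ₗᵢ[ℂ] HTensor A B) (k : C →ₗᵢ[ℂ] C') (x : HTensor A' C) :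
    hassoc (hmap f .id (hmap .id k x)) = hmap .id (hmap .id k) (hassoc (hmap f .id x)) := by
  have hid : (LinearIsometry.id : HTensor A B →ₗᵢ[ℂ] _) = hmap .id .id :=
    LinearIsometry.ext fun x => (hmap_id x).symm
  rw [← hassoc_hmap, hmap_hmap, hmap_hmap, ← hid]
  rfl

/-- `hmap_hmap` with an identity in the first factor. -/
theorem hmap_id_comp (g' : B' →ₗᵢ[ℂ] B'') (g : B →ₗᵢ[ℂ] B') (x : HTensor A B) :
    hmap .id (g'.comp g) x = hmap .id g' (hmap .id g x) := by
  rw [hmap_hmap]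
  rfl

end TensorIdentities

namespace InclusionSystem

variable (E : InclusionSystem.{w})

theorem refMap_refl (t : PosReal) (x : E.Tens (.one t)) : E.refMap (.refl t) x = x := rfl

theorem refMap_keep (t : PosReal) {c d : PosSeq} (h : Ref c d) (x : E.Tens (.cons t c)) :
    E.refMap (.keep t h) x =
      (E.consIso t d).symm (hmap .id (E.refMap h) (E.consIso t c x)) := rfl

theorem refMap_splitOne {s t r : PosReal} {d : PosSeq} (e : s + t = r) (h : Ref (.one t) d)
    (x : E.Tens (.one r)) :
    E.refMap (.splitOne e h) x = (E.consIso s d).symm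
      (hmap .id ((E.refMap h).comp (E.oneIso t).symm.toLinearIsometry) (E.β e (E.oneIso r x))) :=
  rfl

theorem refMap_splitCons {s t r : PosReal} {c d : PosSeq} (e : s + t = r) (h : Ref (.cons t c) d)
    (x : E.Tens (.cons r c)) :
    E.refMap (.splitCons e h) x = (E.consIso s d).symm
      (hmap .id ((E.refMap h).comp (E.consIso t c).symm.toLinearIsometry)
        (hassoc (hmap (E.β e) .id (E.consIso r c x)))) :=
  rfl

theorem refMap_rfl' : (c : PosSeq) → (x : E.Tens c) → E.refMap (Ref.rfl' c) x = x
  | .one t, x => rfl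
  | .cons t c, x => by
    have : E.refMap (Ref.rfl' c) = .id := LinearIsometry.ext (refMap_rfl' c)
    rw [Ref.rfl', refMap_keep, this, hmap_id, LinearIsometryEquiv.symm_apply_apply]

theorem split_split {s t r s' t' q : PosReal} {D : Type*} [NormedAddCommGroup D]
    [InnerProductSpace ℂ D] (e : s + t = r) (e' : s' + t' = s) (e₁ : t' + t = q)
    (e₂ : s' + q = r) (x : HTensor (E.fib r) D) :
    hmap .id hassoc (hmap .id (hmap (E.β e₁) .id) (hassoc (hmap (E.β e₂) .id x))) =
      hassoc (hmap (E.β e') .id (hassoc (hmap (E.β e) .id x))) := by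
  have h : (hmap .id (E.β e₁)).comp (E.β e₂) = hassoc.comp ((hmap (E.β e') .id).comp (E.β e)) :=
    LinearIsometry.ext (E.coassoc e₁ e₂ e' e)
  have hid : (LinearIsometry.id : HTensor (E.fib t) D →ₗᵢ[ℂ] _) = hmap .id .id :=
    LinearIsometry.ext fun x => (hmap_id x).symm
  rw [← hassoc_hmap, hmap_hmap (hmap .id (E.β e₁)), h, hid, ← hassoc_hmap, hmap_hmap,
    ← hassoc_pentagon, hmap_hmap]
  rfl

theorem refMap_trans : {a b c : PosSeq} → (h : Ref a b) → (h' : Ref b c) → (x : E.Tens a) →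
    E.refMap (h.trans h') x = E.refMap h' (E.refMap h x)
  | _, _, _, h, .refl _, x => by rw [Ref.trans, refMap_refl]
  | _, _, _, .keep t h, .keep _ h', x => by
    have := LinearIsometry.ext (f := E.refMap (h.trans h')) (g := (E.refMap h').comp (E.refMap h))
      (refMap_trans h h')
    rw [Ref.trans, refMap_keep, refMap_keep, refMap_keep, LinearIsometryEquiv.apply_symm_apply,
      hmap_hmap, this]
    rfl
  | _, _, _, .splitOne e h, .keep _ h', x => by
    have := LinearIsometry.ext (f := E.refMap (h.trans h')) (g := (E.refMap h').comp (E.refMap h))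
      (refMap_trans h h')
    rw [Ref.trans, refMap_splitOne, refMap_keep, refMap_splitOne,
      LinearIsometryEquiv.apply_symm_apply, hmap_hmap, this]
    rfl
  | _, _, _, .splitCons e h, .keep _ h', x => by
    have := LinearIsometry.ext (f := E.refMap (h.trans h')) (g := (E.refMap h').comp (E.refMap h))
      (refMap_trans h h')
    rw [Ref.trans, refMap_splitCons, refMap_keep, refMap_splitCons,
      LinearIsometryEquiv.apply_symm_apply, hmap_hmap, this]
    rfl
  | _, _, _, .refl _, .splitOne e h', x => by rw [Ref.trans, refMap_refl]
  | _, _, _, .keep _ (c := c) (d := d) h, .splitCons (t := t) e h', x => by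
    have := LinearIsometry.ext (f := E.refMap ((Ref.keep t h).trans h'))
      (g := (E.refMap h').comp (E.refMap (.keep t h))) (refMap_trans (.keep t h) h')
    have h2 : (E.refMap (.keep t h)).comp (E.consIso t c).symm.toLinearIsometry =
        (E.consIso t d).symm.toLinearIsometry.comp (hmap .id (E.refMap h)) := rfl
    have h3 : (Ref.keep _ h).trans (Ref.splitCons e h') =
      .splitCons e (Ref.trans (.keep t h) h') := by rw [Ref.trans]
    rw [h3, refMap_splitCons, refMap_keep, refMap_splitCons, this,
      LinearIsometryEquiv.apply_symm_apply, LinearIsometry.comp_assoc, h2, hassoc_slide,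
      hmap_id_comp, hmap_id_comp, hmap_id_comp]
  | _, _, _, .splitOne (t := t₁) (d := d) e h, .splitCons (s := s) (t := t) e' h', x => by
    have := LinearIsometry.ext (f := E.refMap ((Ref.splitOne rfl h).trans h'))
      (g := (E.refMap h').comp (E.refMap (.splitOne rfl h))) (refMap_trans (.splitOne rfl h) h')
    have h2 : (E.refMap (.splitOne rfl h)).comp (E.oneIso (t + t₁)).symm.toLinearIsometry =
        (E.consIso t d).symm.toLinearIsometry.comp
          ((hmap .id ((E.refMap h).comp (E.oneIso t₁).symm.toLinearIsometry)).comp (E.β rfl)) := rfl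
    rw [Ref.trans, refMap_splitCons, refMap_splitOne, refMap_splitOne, this,
      LinearIsometryEquiv.apply_symm_apply, LinearIsometry.comp_assoc, h2, hassoc_slide,
      ← E.coassoc rfl (by rw [← e, ← e', add_assoc]) e' e]
    simp only [hmap_id_comp]
  | _, _, _, .splitCons (t := t₁) (c := c) (d := d) e h, .splitCons (s := s) (t := t) e' h', x => by
    have := LinearIsometry.ext (f := E.refMap ((Ref.splitCons rfl h).trans h'))
      (g := (E.refMap h').comp (E.refMap (.splitCons rfl h))) (refMap_trans (.splitCons rfl h) h')
    have h2 : (E.refMap (.splitCons rfl h)).comp (E.consIso (t + t₁) c).symm.toLinearIsometry =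
        (E.consIso t d).symm.toLinearIsometry.comp
          ((hmap .id ((E.refMap h).comp (E.consIso t₁ c).symm.toLinearIsometry)).comp
            (hassoc.comp (hmap (E.β rfl) .id))) := rfl
    rw [Ref.trans, refMap_splitCons, refMap_splitCons, refMap_splitCons, this,
      LinearIsometryEquiv.apply_symm_apply, LinearIsometry.comp_assoc, h2, hassoc_slide,
      ← E.split_split e e' rfl (by rw [← e, ← e', add_assoc])]
    simp only [hmap_id_comp]

end InclusionSystem

section Aux

variable {A B C D K F G : Type*}
  [NormedAddCommGroup A] [InnerProductSpace ℂ A]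
  [NormedAddCommGroup B] [InnerProductSpace ℂ B]
  [NormedAddCommGroup C] [InnerProductSpace ℂ C]
  [NormedAddCommGroup D] [InnerProductSpace ℂ D]
  [NormedAddCommGroup F] [InnerProductSpace ℂ F]
  [NormedAddCommGroup G] [InnerProductSpace ℂ G]
  [NormedAddCommGroup K] [InnerProductSpace ℂ K]

/-- Composition of a bilinear map with an isometry. -/
def biPost (g : C →ₗᵢ[ℂ] D) (b : A →L[ℂ] B →L[ℂ] C) : A →L[ℂ] B →L[ℂ] D :=
  (ContinuousLinearMap.compL ℂ B C D g.toContinuousLinearMap).comp b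

@[simp]
theorem biPost_apply (g : C →ₗᵢ[ℂ] D) (b : A →L[ℂ] B →L[ℂ] C) (x : A) (y : B) :
    biPost g b x y = g (b x y) := rfl

theorem InnerMul.post (g : C →ₗᵢ[ℂ] D) {b : A →L[ℂ] B →L[ℂ] C} (hb : InnerMul b.toLinearMap) :
    InnerMul (biPost g b).toLinearMap := by
  intro x x' y y'
  simpa using hb x x' y y'

theorem InnerMul.pre {b : A →L[ℂ] B →L[ℂ] C} (hb : InnerMul b.toLinearMap) (g : D →ₗᵢ[ℂ] A) :
    InnerMul (b.comp g.toContinuousLinearMap).toLinearMap := by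
  intro x x' y y'
  simpa using hb (g x) (g x') y y'

theorem htensor_mem {g : HTensor A B →L[ℂ] K} {M : Submodule ℂ K} (hM : IsClosed (M : Set K))
    (h : ∀ x y, g (htmul x y) ∈ M) (v : HTensor A B) : g v ∈ M := by
  let q : Submodule ℂ (HTensor A B) := M.comap g.toLinearMap
  have hq : IsClosed (q : Set (HTensor A B)) := hM.preimage g.continuous
  have h2 : ∀ z : A ⊗[ℂ] B, (show HTensor A B from (z : Completion (A ⊗[ℂ] B))) ∈ q := by
    intro z
    induction z using TensorProduct.induction_on with
    | zero => exact q.zero_mem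
    | tmul x y => exact h x y
    | add a b ha hb =>
      have := q.add_mem ha hb
      convert this using 1
      exact Completion.coe_add a b
  exact Completion.induction_on (α := A ⊗[ℂ] B) (p := fun v => (show HTensor A B from v) ∈ q) v
    hq h2

theorem biComp_hmap [CompleteSpace K] {b : A →L[ℂ] G →L[ℂ] K} (hb : InnerMul b.toLinearMap)
    {d : B →L[ℂ] F →L[ℂ] G} (hd : InnerMul d.toLinearMap)
    {d' : C →L[ℂ] F →L[ℂ] G} (hd' : InnerMul d'.toLinearMap) (k : B →ₗᵢ[ℂ] C)
    (hk : ∀ x, d' (k x) = d x) (v : HTensor A B) :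
    biComp b hb d' hd' (hmap .id k v) = biComp b hb d hd v := by
  refine DFunLike.congr_fun (f := (biComp b hb d' hd').comp (hmap .id k).toContinuousLinearMap)
    (htensor_ext fun x y => ?_) v
  ext z
  simp [hk]

theorem biComp_hassoc [CompleteSpace K] [CompleteSpace G]
    {b : A →L[ℂ] G →L[ℂ] K} (hb : InnerMul b.toLinearMap)
    {d : B →L[ℂ] F →L[ℂ] G} (hd : InnerMul d.toLinearMap)
    {e : C →L[ℂ] D →L[ℂ] F} (he : InnerMul e.toLinearMap) (v : HTensor A B) (w : C) (z : D) :
    biComp b hb (biComp d hd e he) (innerMul_biComp d hd e he) (hassoc (htmul v w)) z =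
      biComp b hb d hd v (e w z) := by
  let Φ := biComp b hb (biComp d hd e he) (innerMul_biComp d hd e he)
  refine DFunLike.congr_fun
    (f := (Φ.flip z).comp (hassoc.toContinuousLinearMap.comp (htmul.flip w)))
    (g := (biComp b hb d hd).flip (e w z)) (htensor_ext fun x y => ?_) v
  simp [Φ]

end Aux

namespace InclusionSystem

variable (E : InclusionSystem.{w})

/-! ### The product system generated by an inclusion system -/

/-- The isometries `E_c → E_d` for `c ≤ d` in `J_T`. -/
def sys (T : PosReal) (c d : Subdiv T) (h : c ≤ d) : E.Tens c.1 →ₗᵢ[ℂ] E.Tens d.1 :=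
  E.refMap h.some

instance (T : PosReal) : DirectedSystem (fun c : Subdiv T => E.Tens c.1) (E.sys T · · ·) where
  map_self c x := by
    change E.refMap _ x = x
    rw [Subsingleton.elim (Nonempty.some _) (Ref.rfl' c.1), refMap_rfl']
  map_map i j k h h' x := by
    change E.refMap _ (E.refMap _ x) = E.refMap _ x
    rw [← refMap_trans, Subsingleton.elim (Ref.trans _ _)]

/-- The inductive limit of the Hilbert spaces `E_c`, `c ∈ J_T`. -/
def Gen (T : PosReal) : Type w := IndLim (E.sys T)

instance (T : PosReal) : NormedAddCommGroup (E.Gen T) :=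
  inferInstanceAs (NormedAddCommGroup (IndLim (E.sys T)))
instance (T : PosReal) : InnerProductSpace ℂ (E.Gen T) :=
  inferInstanceAs (InnerProductSpace ℂ (IndLim (E.sys T)))
instance (T : PosReal) : CompleteSpace (E.Gen T) :=
  inferInstanceAs (CompleteSpace (IndLim (E.sys T)))

/-- The canonical isometries from `E_c`, `c ∈ J_T`, into the inductive limit. -/
def can {T : PosReal} (c : PosSeq) (h : c.total = T) : E.Tens c →ₗᵢ[ℂ] E.Gen T :=
  limOf (E.sys T) ⟨c, h⟩

theorem can_refMap {T : PosReal} {c d : PosSeq} (r : Ref c d) (hc : c.total = T)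
    (hd : d.total = T) (x : E.Tens c) : E.can d hd (E.refMap r x) = E.can c hc x := by
  have := limOf_map (E.sys T) ⟨c, hc⟩ ⟨d, hd⟩ ⟨r⟩ x
  rw [sys, Subsingleton.elim (Nonempty.some _) r] at this
  exact this

theorem gen_ext {T : PosReal} {K : Type*} [NormedAddCommGroup K] [InnerProductSpace ℂ K]
    {f g : E.Gen T →L[ℂ] K} (h : ∀ c hc x, f (E.can c hc x) = g (E.can c hc x)) : f = g :=
  indLim_ext (f := E.sys T) fun c x => h c.1 c.2 x

/-- The family defining `consMul`. -/
def consFam {a S T : PosReal} (h : a + S = T) (c : Subdiv S) :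
    E.Tens c.1 →L[ℂ] E.fib a →L[ℂ] E.Gen T :=
  (biPost ((E.can (.cons a c.1) (PosSeq.total_cons h c.2)).comp
    (E.consIso a c.1).symm.toLinearIsometry) htmul).flip

theorem innerMul_consFam {a S T : PosReal} (h : a + S = T) (c : Subdiv S) :
    InnerMul (E.consFam h c).toLinearMap :=
  (innerMul_htmul.post _).flip

theorem consFam_compat {a S T : PosReal} (h : a + S = T) (c d : Subdiv S) (r : c ≤ d)
    (x : E.Tens c.1) : E.consFam h d (E.sys S c d r x) = E.consFam h c x := by
  ext e
  have := E.can_refMap (T := T) (.keep a r.some) (PosSeq.total_cons h c.2)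
    (PosSeq.total_cons h d.2) ((E.consIso a c.1).symm (htmul e x))
  rw [refMap_keep, LinearIsometryEquiv.apply_symm_apply, hmap_htmul] at this
  exact this

/-- Left multiplication by elements of `E_a`: `(e, i_c x) ↦ i_(a ⌣ c) (e ⊗ x)`. -/
def consMul {a S T : PosReal} (h : a + S = T) : E.fib a →L[ℂ] E.Gen S →L[ℂ] E.Gen T :=
  ContinuousLinearMap.flip (E := E.Gen S)
    (limBi (E.sys S) (E.consFam h) (E.consFam_compat h) (E.innerMul_consFam h))

theorem innerMul_consMul {a S T : PosReal} (h : a + S = T) :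
    InnerMul (E.consMul h).toLinearMap :=
  InnerMul.flip (E := E.Gen S) (innerMul_limBi _ _ _ _)

theorem consMul_can {a S T : PosReal} (h : a + S = T) (e : E.fib a) (c : PosSeq)
    (hc : c.total = S) (x : E.Tens c) :
    E.consMul h e (E.can c hc x) =
      E.can (.cons a c) (PosSeq.total_cons h hc) ((E.consIso a c).symm (htmul e x)) :=
  DFunLike.congr_fun (limBi_limOf (E.sys S) (E.consFam h) (E.consFam_compat h)
    (E.innerMul_consFam h) ⟨c, hc⟩ x) e

/-- Left multiplication by elements of `E_c`, with its compatibility with inner products. -/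
def mulAux : (c : PosSeq) → {S T : PosReal} → c.total + S = T →
    {b : E.Tens c →L[ℂ] E.Gen S →L[ℂ] E.Gen T // InnerMul b.toLinearMap}
  | .one a, _, _, h =>
    ⟨(E.consMul (a := a) h).comp (E.oneIso a).toLinearIsometry.toContinuousLinearMap,
      (E.innerMul_consMul h).pre (E.oneIso a).toLinearIsometry⟩
  | .cons a c, _, _, h =>
    ⟨(biComp (E.consMul (a := a) ((add_assoc _ _ _).symm.trans h)) (E.innerMul_consMul _)
      (mulAux c rfl).1 (mulAux c rfl).2).comp (E.consIso a c).toLinearIsometry.toContinuousLinearMap,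
      (innerMul_biComp _ _ _ _).pre (E.consIso a c).toLinearIsometry⟩

/-- Left multiplication by elements of `E_c`: `(x, i_d y) ↦ i_(c ⌣ d) (x ⊗ y)`. -/
def mul (c : PosSeq) {S T : PosReal} (h : c.total + S = T) :
    E.Tens c →L[ℂ] E.Gen S →L[ℂ] E.Gen T :=
  (E.mulAux c h).1

theorem innerMul_mul (c : PosSeq) {S T : PosReal} (h : c.total + S = T) :
    InnerMul (E.mul c h).toLinearMap := (E.mulAux c h).2

theorem mul_one {a S T : PosReal} (h : a + S = T) (x : E.Tens (.one a)) :
    E.mul (.one a) h x = E.consMul h (E.oneIso a x) := rfl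

theorem mul_cons {a : PosReal} {c : PosSeq} {S S' T : PosReal} (h : (PosSeq.cons a c).total + S = T)
    (h₁ : c.total + S = S') (h₂ : a + S' = T) (x : E.Tens (.cons a c)) :
    E.mul (.cons a c) h x = biComp (E.consMul h₂) (E.innerMul_consMul h₂) (E.mul c h₁)
      (E.innerMul_mul c h₁) (E.consIso a c x) := by
  subst h₁
  rfl

theorem consMul_split {s t r S S' T : PosReal} (e : s + t = r) (h : r + S = T) (h₁ : t + S = S')
    (h₂ : s + S' = T) (x : E.fib r) :
    E.consMul h x = biComp (E.consMul h₂) (E.innerMul_consMul h₂) (E.consMul h₁)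
      (E.innerMul_consMul h₁) (E.β e x) := by
  refine E.gen_ext fun c hc w => ?_
  have key : ∀ v : HTensor (E.fib s) (E.fib t),
      biComp (E.consMul h₂) (E.innerMul_consMul h₂) (E.consMul h₁)
        (E.innerMul_consMul h₁) v (E.can c hc w) =
      E.can (.cons s (.cons t c)) (by rw [← h₂, ← h₁, ← hc]; rfl)
        ((E.consIso s _).symm (hmap .id (E.consIso t c).symm.toLinearIsometry
          (hassoc (htmul v w)))) := by
    intro v
    let k : HTensor (E.fib s) (HTensor (E.fib t) (E.Tens c)) →ₗᵢ[ℂ] E.Gen T :=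
      (E.can (.cons s (.cons t c)) (by rw [← h₂, ← h₁, ← hc]; rfl)).comp
        ((E.consIso s _).symm.toLinearIsometry.comp
          (hmap .id (E.consIso t c).symm.toLinearIsometry))
    refine DFunLike.congr_fun
      (f := (biComp (E.consMul h₂) (E.innerMul_consMul h₂) (E.consMul h₁)
        (E.innerMul_consMul h₁)).flip (E.can c hc w))
      (g := k.toContinuousLinearMap.comp (hassoc.toContinuousLinearMap.comp (htmul.flip w)))
      (htensor_ext fun p q => ?_) v
    simp [k, consMul_can]
  have h3 := E.can_refMap (.splitCons e (Ref.rfl' (.cons t c))) (T := T)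
    (by rw [← h, ← hc]; rfl) (by rw [← h₂, ← h₁, ← hc]; rfl) ((E.consIso r c).symm (htmul x w))
  have h4 : E.refMap (Ref.rfl' (.cons t c)) = .id := LinearIsometry.ext (E.refMap_rfl' _)
  rw [consMul_can, key, ← h3, refMap_splitCons, h4, LinearIsometryEquiv.apply_symm_apply,
    hmap_htmul]
  rfl

theorem mul_refMap : {c d : PosSeq} → (r : Ref c d) → {S T : PosReal} → (hc : c.total + S = T) →
    (hd : d.total + S = T) → (x : E.Tens c) → E.mul d hd (E.refMap r x) = E.mul c hc x
  | _, _, .refl _, _, _, _, _, _ => rfl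
  | _, _, .keep t (c := c) (d := d) r, S, T, hc, hd, x => by
    have h₁ : c.total + S = d.total + S := by rw [r.total_eq]
    rw [E.mul_cons hd rfl ((add_assoc _ _ _).symm.trans hd),
      E.mul_cons hc h₁ ((add_assoc _ _ _).symm.trans hd), refMap_keep,
      LinearIsometryEquiv.apply_symm_apply]
    exact biComp_hmap _ _ _ _ (fun y => mul_refMap r h₁ rfl y) _
  | _, _, .splitOne (s := s) (t := t) (r := a) (d := d) e r, S, T, hc, hd, x => by
    have h₁ : t + S = d.total + S := by rw [← r.total_eq]; rfl
    rw [E.mul_cons hd rfl ((add_assoc _ _ _).symm.trans hd)]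
    change _ = E.consMul (a := a) hc (E.oneIso a x)
    rw [E.consMul_split e hc h₁ ((add_assoc _ _ _).symm.trans hd), refMap_splitOne,
      LinearIsometryEquiv.apply_symm_apply]
    exact biComp_hmap _ _ _ _ (fun y => mul_refMap r h₁ rfl _) _
  | _, _, .splitCons (s := s) (t := t) (r := a) (c := c) (d := d) e r, S, T, hc, hd, x => by
    have h₁ : (PosSeq.cons t c).total + S = d.total + S := by rw [← r.total_eq]
    have h₂ := (add_assoc _ _ _).symm.trans hd
    have h₃ : t + (c.total + S) = d.total + S := (add_assoc _ _ _).symm.trans h₁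
    have h₄ : a + (c.total + S) = T := (add_assoc _ _ _).symm.trans hc
    rw [E.mul_cons hd rfl h₂, E.mul_cons hc rfl h₄, refMap_splitCons,
      LinearIsometryEquiv.apply_symm_apply]
    rw [biComp_hmap (E.innerMul_consMul h₂)
      (innerMul_biComp (E.consMul h₃) (E.innerMul_consMul h₃) (E.mul c rfl) (E.innerMul_mul c rfl))
      (E.innerMul_mul d rfl) _ (fun y => by
        have := mul_refMap r h₁ rfl ((E.consIso t c).symm y)
        rw [E.mul_cons h₁ rfl h₃, LinearIsometryEquiv.apply_symm_apply] at this
        exact this)]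
    generalize E.consIso a c x = y
    let Φ := biComp (E.consMul h₂) (E.innerMul_consMul h₂) _ (innerMul_biComp (E.consMul h₃)
      (E.innerMul_consMul h₃) (E.mul c rfl) (E.innerMul_mul c rfl))
    refine DFunLike.congr_fun (f := Φ.comp (hassoc.toContinuousLinearMap.comp
      (hmap (E.β e) .id).toContinuousLinearMap)) (htensor_ext fun p q => ?_) y
    ext z
    have h5 := biComp_hassoc (E.innerMul_consMul h₂) (E.innerMul_consMul h₃)
      (E.innerMul_mul c rfl) (E.β e p) q z
    simp only [Φ, ContinuousLinearMap.comp_apply, LinearIsometry.coe_toContinuousLinearMap,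
      hmap_htmul, biComp_htmul, LinearIsometry.coe_id, id]
    rw [h5, ← E.consMul_split e h₄ h₃ h₂]

end InclusionSystem

namespace InclusionSystem

variable (E : InclusionSystem.{w})

theorem mulFam_eq {R S T : PosReal} (h : R + S = T) (c : Subdiv R) : c.1.total + S = T := by
  rw [c.2, h]

/-- The multiplication of the generated product system: `(i_c x, i_d y) ↦ i_(c ⌣ d) (x ⊗ y)`. -/
def genMul {R S T : PosReal} (h : R + S = T) : E.Gen R →L[ℂ] E.Gen S →L[ℂ] E.Gen T :=
  limBi (E.sys R) (fun c => E.mul c.1 (mulFam_eq h c))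
    (fun _ _ r => E.mul_refMap r.some _ _) (fun c => E.innerMul_mul c.1 _)

theorem innerMul_genMul {R S T : PosReal} (h : R + S = T) :
    InnerMul (E.genMul h).toLinearMap :=
  innerMul_limBi (E.sys R) _ _ _

theorem genMul_can {R S T : PosReal} (h : R + S = T) (c : PosSeq) (hc : c.total = R)
    (x : E.Tens c) (y : E.Gen S) :
    E.genMul h (E.can c hc x) y = E.mul c (by rw [hc, h]) x y :=
  DFunLike.congr_fun (limBi_limOf (E.sys R) (fun c => E.mul c.1 (mulFam_eq h c))
    (fun _ _ r => E.mul_refMap r.some _ _) (fun c => E.innerMul_mul c.1 _) ⟨c, hc⟩ x) y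

/-- The isometry `i_c x ⊗ i_d y ↦ i_(c ⌣ d) (x ⊗ y)`. -/
def genIso {R S T : PosReal} (h : R + S = T) : HTensor (E.Gen R) (E.Gen S) →ₗᵢ[ℂ] E.Gen T :=
  hlift (E.genMul h) (E.innerMul_genMul h)

theorem genIso_htmul {R S T : PosReal} (h : R + S = T) (x : E.Gen R) (y : E.Gen S) :
    E.genIso h (htmul x y) = E.genMul h x y :=
  hlift_htmul _ _ _ _

theorem consMul_genMul {a R S RS aR T : PosReal} (h₁ : R + S = RS) (h₂ : a + RS = T)
    (h₃ : a + R = aR) (h₄ : aR + S = T) (e : E.fib a) (y : E.Gen R) (z : E.Gen S) :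
    E.consMul h₂ e (E.genMul h₁ y z) = E.genMul h₄ (E.consMul h₃ e y) z := by
  refine DFunLike.congr_fun (f := (E.consMul h₂ e).comp ((E.genMul h₁).flip z))
    (g := ((E.genMul h₄).flip z).comp (E.consMul h₃ e)) (E.gen_ext fun d hd w => ?_) y
  simp only [ContinuousLinearMap.comp_apply, ContinuousLinearMap.flip_apply, genMul_can,
    consMul_can]
  rw [E.mul_cons _ (by rw [hd, h₁]) h₂, LinearIsometryEquiv.apply_symm_apply, biComp_htmul]

theorem mul_genMul : (c : PosSeq) → {R S RS cR T : PosReal} → (h₁ : R + S = RS) →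
    (h₂ : c.total + RS = T) → (h₃ : c.total + R = cR) → (h₄ : cR + S = T) → (x : E.Tens c) →
    (y : E.Gen R) → (z : E.Gen S) →
    E.mul c h₂ x (E.genMul h₁ y z) = E.genMul h₄ (E.mul c h₃ x y) z
  | .one a, _, _, _, _, _, h₁, h₂, h₃, h₄, x, y, z =>
    E.consMul_genMul (a := a) h₁ h₂ h₃ h₄ (E.oneIso a x) y z
  | .cons a c, R, S, RS, cR, T, h₁, h₂, h₃, h₄, x, y, z => by
    have k₂ : a + (c.total + RS) = T := (add_assoc _ _ _).symm.trans h₂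
    have k₃ : a + (c.total + R) = cR := (add_assoc _ _ _).symm.trans h₃
    rw [E.mul_cons h₂ rfl k₂, E.mul_cons h₃ rfl k₃]
    generalize E.consIso a c x = v
    refine DFunLike.congr_fun
      (f := (biComp (E.consMul k₂) (E.innerMul_consMul k₂) (E.mul c rfl)
        (E.innerMul_mul c rfl)).flip (E.genMul h₁ y z))
      (g := ((E.genMul h₄).flip z).comp ((biComp (E.consMul k₃) (E.innerMul_consMul k₃)
        (E.mul c rfl) (E.innerMul_mul c rfl)).flip y)) (htensor_ext fun p q => ?_) v
    simp only [ContinuousLinearMap.comp_apply, ContinuousLinearMap.flip_apply, biComp_htmul]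
    have k₅ : (c.total + R) + S = c.total + RS := by rw [add_assoc, h₁]
    rw [mul_genMul c h₁ rfl rfl k₅ q y z, E.consMul_genMul k₅ k₂ k₃ h₄]

theorem genMul_assoc {P R S PR RS T : PosReal} (h₁ : R + S = RS) (h₂ : P + RS = T)
    (h₃ : P + R = PR) (h₄ : PR + S = T) (x : E.Gen P) (y : E.Gen R) (z : E.Gen S) :
    E.genMul h₂ x (E.genMul h₁ y z) = E.genMul h₄ (E.genMul h₃ x y) z := by
  refine DFunLike.congr_fun (f := (E.genMul h₂).flip (E.genMul h₁ y z))
    (g := ((E.genMul h₄).flip z).comp ((E.genMul h₃).flip y)) (E.gen_ext fun c hc w => ?_) x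
  simp only [ContinuousLinearMap.comp_apply, ContinuousLinearMap.flip_apply, genMul_can]
  exact E.mul_genMul c _ _ _ _ _ _ _

/-- The range of `genIso`. -/
def genRange {R S T : PosReal} (h : R + S = T) : Submodule ℂ (E.Gen T) :=
  LinearMap.range (E.genIso h).toLinearMap

theorem isClosed_genRange {R S T : PosReal} (h : R + S = T) :
    IsClosed (E.genRange h : Set (E.Gen T)) := by
  have := (E.genIso h).isometry.isClosedEmbedding.isClosed_range
  rw [genRange, LinearMap.coe_range]
  exact this

theorem genMul_mem {R S T : PosReal} (h : R + S = T) (x : E.Gen R) (y : E.Gen S) :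
    E.genMul h x y ∈ E.genRange h :=
  ⟨htmul x y, E.genIso_htmul h x y⟩

theorem can_cons_mem {R S T : PosReal} (h : R + S = T) (c : PosSeq) (hc : c.total = S)
    (x : E.Tens (.cons R c)) : E.can (.cons R c) (PosSeq.total_cons h hc) x ∈ E.genRange h := by
  have := htensor_mem (E.isClosed_genRange h) (g := ((E.can (.cons R c)
    (PosSeq.total_cons h hc)).comp (E.consIso R c).symm.toLinearIsometry).toContinuousLinearMap)
    (fun p q => by
      have := E.genMul_mem h (E.can (.one R) (show (PosSeq.one R).total = R from rfl)
        ((E.oneIso R).symm p)) (E.can c hc q)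
      rw [genMul_can] at this
      change E.consMul h p _ ∈ _ at this
      rw [consMul_can] at this
      exact this) (E.consIso R c x)
  simpa using this

theorem can_mem : (c : PosSeq) → {R S T : PosReal} → (h : R + S = T) → (hc : c.total = T) →
    (x : E.Tens c) → E.can c hc x ∈ E.genRange h
  | .one t, R, S, T, h, hc, x => by
    have e : R + S = t := h.trans hc.symm
    rw [← E.can_refMap (.splitOne e (.refl S)) hc (PosSeq.total_cons h rfl)]
    exact E.can_cons_mem h (.one S) rfl _
  | .cons a c, R, S, T, h, hc, x => by
    rcases PosReal.trichotomy a R with rfl | ⟨r, rfl⟩ | ⟨r, rfl⟩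
    · exact E.can_cons_mem h c (Ref.pos_add_cancel (hc.trans h.symm)) x
    · have h₁ : r + S = c.total := by
        refine Ref.pos_add_cancel (s := a) ?_
        rw [← add_assoc, h]
        exact hc.symm
      have h₂ : a + c.total = T := hc
      have key : ∀ p q, E.consMul h₂ p (E.can c rfl q) ∈ E.genRange h := by
        intro p q
        obtain ⟨v, hv⟩ := can_mem c h₁ rfl q
        rw [← hv]
        exact htensor_mem (E.isClosed_genRange h)
          (g := (E.consMul h₂ p).comp (E.genIso h₁).toContinuousLinearMap) (fun y z => by
            change E.consMul h₂ p (E.genIso h₁ (htmul y z)) ∈ _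
            rw [genIso_htmul, E.consMul_genMul h₁ h₂ rfl h]
            exact E.genMul_mem h _ _) v
      have := htensor_mem (E.isClosed_genRange h) (g := ((E.can (.cons a c) hc).comp
        (E.consIso a c).symm.toLinearIsometry).toContinuousLinearMap)
        (fun p q => by
          have := key p q
          rw [consMul_can] at this
          exact this) (E.consIso a c x)
      simpa using this
    · have h₁ : r + c.total = S := by
        refine Ref.pos_add_cancel (s := R) ?_
        rw [← add_assoc, h]
        exact hc
      rw [← E.can_refMap (.splitCons rfl (Ref.rfl' (.cons r c))) hc (PosSeq.total_cons h h₁)]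
      exact E.can_cons_mem h (.cons r c) h₁ _

theorem gen_mem {T : PosReal} {M : Submodule ℂ (E.Gen T)} (hM : IsClosed (M : Set (E.Gen T)))
    (h : ∀ c hc x, E.can c hc x ∈ M) (v : E.Gen T) : v ∈ M := by
  refine Completion.induction_on (α := PreLim (E.sys T)) (p := fun v => (show E.Gen T from v) ∈ M)
    v hM fun z => ?_
  obtain ⟨c, x, rfl⟩ := exists_preOf (E.sys T) z
  exact h c.1 c.2 x

theorem genIso_surjective {R S T : PosReal} (h : R + S = T) :
    Function.Surjective (E.genIso h) := fun v =>
  E.gen_mem (E.isClosed_genRange h) (fun c hc x => E.can_mem c h hc x) v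

/-- The unitary structure maps `B_{R,S} : 𝓔_(R+S) → 𝓔_R ⊗ 𝓔_S` of the generated product system,
determined by `B_{R,S} (i_(c ⌣ d) (x ⊗ y)) = i_c x ⊗ i_d y`. -/
def genB {R S T : PosReal} (h : R + S = T) : E.Gen T ≃ₗᵢ[ℂ] HTensor (E.Gen R) (E.Gen S) :=
  (LinearIsometryEquiv.ofSurjective (E.genIso h) (E.genIso_surjective h)).symm

theorem genB_genMul {R S T : PosReal} (h : R + S = T) (x : E.Gen R) (y : E.Gen S) :
    E.genB h (E.genMul h x y) = htmul x y := by
  rw [genB, LinearIsometryEquiv.symm_apply_eq, LinearIsometryEquiv.coe_ofSurjective, genIso_htmul]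

/-- The concatenation `c ⌣ d` of two sequences. -/
def _root_.PosSeq.append : PosSeq → PosSeq → PosSeq
  | .one t, d => .cons t d
  | .cons t c, d => .cons t (c.append d)

theorem _root_.PosSeq.total_append : (c d : PosSeq) → (c.append d).total = c.total + d.total
  | .one _, _ => rfl
  | .cons t c, d => (congrArg (t + ·) (total_append c d)).trans (add_assoc _ _ _).symm

/-- The identification of `E_c ⊗ E_d` with `E_(c ⌣ d)`. -/
def join : (c d : PosSeq) → HTensor (E.Tens c) (E.Tens d) →ₗᵢ[ℂ] E.Tens (c.append d)
  | .one t, d => (E.consIso t d).symm.toLinearIsometry.comp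
      (hmap (E.oneIso t).toLinearIsometry .id)
  | .cons t c, d => (E.consIso t (c.append d)).symm.toLinearIsometry.comp
      ((hmap .id (join c d)).comp (hassoc.comp (hmap (E.consIso t c).toLinearIsometry .id)))

theorem join_one_htmul (a : PosReal) (d : PosSeq) (x : E.Tens (.one a)) (y : E.Tens d) :
    E.join (.one a) d (htmul x y) = (E.consIso a d).symm (htmul (E.oneIso a x) y) :=
  congrArg (E.consIso a d).symm (hmap_htmul (E.oneIso a).toLinearIsometry .id x y)

theorem join_cons_htmul (a : PosReal) (c d : PosSeq) (x : E.Tens (.cons a c)) (y : E.Tens d) :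
    E.join (.cons a c) d (htmul x y) = (E.consIso a (c.append d)).symm
      (hmap .id (E.join c d) (hassoc (htmul (E.consIso a c x) y))) :=
  congrArg (fun z => (E.consIso a (c.append d)).symm (hmap .id (E.join c d) (hassoc z)))
    (hmap_htmul (E.consIso a c).toLinearIsometry .id x y)

/-- The induction step of `mul_can`. -/
theorem mul_can_cons {a : PosReal} {c d : PosSeq} {S S' T : PosReal} (h₁ : c.total + S = S')
    (h₂ : a + S' = T) (hd : d.total = S) (hcd : (c.append d).total = S')
    (ih : ∀ x y, E.mul c h₁ x (E.can d hd y) = E.can (c.append d) hcd (E.join c d (htmul x y)))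
    (v : HTensor (E.fib a) (E.Tens c)) (y : E.Tens d) :
    biComp (E.consMul h₂) (E.innerMul_consMul h₂) (E.mul c h₁) (E.innerMul_mul c h₁) v
      (E.can d hd y) = E.can (.cons a (c.append d)) (PosSeq.total_cons h₂ hcd)
        ((E.consIso a (c.append d)).symm (hmap .id (E.join c d) (hassoc (htmul v y)))) := by
  let k : HTensor (E.fib a) (HTensor (E.Tens c) (E.Tens d)) →ₗᵢ[ℂ] E.Gen T :=
    (E.can (.cons a (c.append d)) (PosSeq.total_cons h₂ hcd)).comp
      ((E.consIso a (c.append d)).symm.toLinearIsometry.comp (hmap .id (E.join c d)))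
  refine DFunLike.congr_fun
    (f := (biComp (E.consMul h₂) (E.innerMul_consMul h₂) (E.mul c h₁)
      (E.innerMul_mul c h₁)).flip (E.can d hd y))
    (g := k.toContinuousLinearMap.comp (hassoc.toContinuousLinearMap.comp (htmul.flip y)))
    (htensor_ext fun p q => ?_) v
  simp [k, ih, consMul_can]

theorem mul_can (c d : PosSeq) : ∀ {S T : PosReal} (h : c.total + S = T) (hd : d.total = S)
    (hcd : (c.append d).total = T) (x : E.Tens c) (y : E.Tens d),
    E.mul c h x (E.can d hd y) = E.can (c.append d) hcd (E.join c d (htmul x y)) := by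
  induction c with
  | one a =>
    intro S T h hd hcd x y
    rw [join_one_htmul]
    exact E.consMul_can (a := a) h (E.oneIso a x) d hd y
  | cons a c ih =>
    intro S T h hd hcd x y
    have h₂ : a + (c.total + S) = T := (add_assoc _ _ _).symm.trans h
    have h₃ : (c.append d).total = c.total + S := by rw [PosSeq.total_append, hd]
    rw [join_cons_htmul, E.mul_cons h rfl h₂]
    exact E.mul_can_cons rfl h₂ hd h₃ (ih rfl hd h₃) _ y

/-- The defining property of the structure maps of the generated product system. -/
theorem genB_can {R S T : PosReal} (h : R + S = T) (c d : PosSeq) (hc : c.total = R)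
    (hd : d.total = S) (x : E.Tens c) (y : E.Tens d) :
    E.genB h (E.can (c.append d) (by rw [PosSeq.total_append, hc, hd, h])
      (E.join c d (htmul x y))) = htmul (E.can c hc x) (E.can d hd y) := by
  rw [← E.genB_genMul h, genMul_can, E.mul_can c d _ hd]

theorem genB_genIso {R S T : PosReal} (h : R + S = T) (v : HTensor (E.Gen R) (E.Gen S)) :
    E.genB h (E.genIso h v) = v :=
  (LinearIsometryEquiv.ofSurjective (E.genIso h) (E.genIso_surjective h)).symm_apply_apply v

theorem genB_coassoc {r s t rs st rst : PosReal} (h₁ : s + t = st) (h₂ : r + st = rst)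
    (h₃ : r + s = rs) (h₄ : rs + t = rst) (x : E.Gen rst) :
    hmap .id (E.genB h₁).toLinearIsometry ((E.genB h₂).toLinearIsometry x) =
      hassoc (hmap (E.genB h₃).toLinearIsometry .id ((E.genB h₄).toLinearIsometry x)) := by
  obtain ⟨v, rfl⟩ := E.genIso_surjective h₄ x
  change _ = hassoc (hmap (E.genB h₃).toLinearIsometry .id (E.genB h₄ (E.genIso h₄ v)))
  rw [genB_genIso]
  have h5 : v = hmap (E.genIso h₃) .id (hmap (E.genB h₃).toLinearIsometry .id v) := by
    have : (E.genIso h₃).comp (E.genB h₃).toLinearIsometry = .id :=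
      LinearIsometry.ext fun y => (LinearIsometryEquiv.ofSurjective (E.genIso h₃)
        (E.genIso_surjective h₃)).apply_symm_apply y
    rw [hmap_hmap, this, LinearIsometry.comp_id, hmap_id]
  generalize hmap (E.genB h₃).toLinearIsometry (.id : E.Gen t →ₗᵢ[ℂ] E.Gen t) v = w at h5 ⊢
  subst h5
  refine DFunLike.congr_fun (f := (hmap .id (E.genB h₁).toLinearIsometry).comp
    ((E.genB h₂).toLinearIsometry.comp ((E.genIso h₄).comp (hmap (E.genIso h₃) .id))))
    (htensor_iso_ext₃ fun p q z => ?_) w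
  change hmap .id (E.genB h₁).toLinearIsometry (E.genB h₂ (E.genIso h₄
    (hmap (E.genIso h₃) .id (htmul (htmul p q) z)))) = _
  rw [hmap_htmul, genIso_htmul, genIso_htmul, LinearIsometry.id_apply,
    ← E.genMul_assoc h₁ h₂, genB_genMul, hmap_htmul, hassoc_htmul]
  exact congrArg (htmul p) (E.genB_genMul h₁ q z)

/-- The product system generated by an inclusion system. -/
def generated : InclusionSystem.{w} where
  fib := E.Gen
  β h := (E.genB h).toLinearIsometry
  coassoc := E.genB_coassoc

/-- A product system is an inclusion system whose structure maps are unitary. -/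
def IsProductSystem : Prop :=
  ∀ {s t r : PosReal} (h : s + t = r), Function.Surjective (E.β h)

theorem isProductSystem_generated : E.generated.IsProductSystem :=
  fun h => (E.genB h).surjective

/-- The canonical isometries `i_T : E_T → 𝓔_T`. -/
def canon (T : PosReal) : E.fib T →ₗᵢ[ℂ] E.generated.fib T :=
  (E.can (.one T) rfl).comp (E.oneIso T).symm.toLinearIsometry

/-! ### Units, addits and roots -/

/-- Sections of an inclusion system. -/
abbrev Sec : Type w := ∀ t, E.fib t

/-- The adjoint of the structure map `β s t`. -/
def βadj {s t r : PosReal} (h : s + t = r) : HTensor (E.fib s) (E.fib t) →L[ℂ] E.fib r :=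
  ContinuousLinearMap.adjoint (E.β h).toContinuousLinearMap

variable {E}

/-- `u` is a unit: a nonzero section with `u (s + t) = (β s t)* (u s ⊗ u t)` which is
quasicontractive, that is, `exp (-k t) ‖u t‖ ≤ 1` for some real `k`. -/
structure IsUnit (u : E.Sec) : Prop where
  ne_zero : u ≠ 0
  quasicontractive : ∃ k : ℝ, ∀ t : PosReal, Real.exp (-k * t) * ‖u t‖ ≤ 1
  mul : ∀ {s t r : PosReal} (h : s + t = r), u r = E.βadj h (htmul (u s) (u t))

/-- `u` is normalised. -/
def IsNormalised (u : E.Sec) : Prop := ∀ t, ‖u t‖ = 1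

/-- `a` is an addit of `(E, u)`. -/
structure IsAddit (u a : E.Sec) : Prop where
  add : ∀ {s t r : PosReal} (h : s + t = r),
    a r = E.βadj h (htmul (a s) (u t) + htmul (u s) (a t))
  bound : ∃ k : ℝ, 0 ≤ k ∧ ∀ t : PosReal, ‖a t‖ ^ 2 ≤ k * (t + (t : ℝ) ^ 2)

/-- `a` is a root of `(E, u)`: an addit with `a t` orthogonal to `u t` for all `t`. -/
structure IsRoot (u a : E.Sec) : Prop extends IsAddit u a where
  orthogonal : ∀ t, ⟪a t, u t⟫_ℂ = 0

variable (E)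

/-- The map `b ↦ ((i_t)* b_t)_t` from sections of the generated product system to sections
of `E`. -/
def canonAdj (b : E.generated.Sec) : E.Sec :=
  fun t => ContinuousLinearMap.adjoint (E.canon t).toContinuousLinearMap (b t)

variable {E}

/-- `v` is a lift of the unit `u`: a unit of the generated product system with `(i_t)* v_t = u_t`
for all `t`. -/
def IsLift (u : E.Sec) (v : E.generated.Sec) : Prop := IsUnit v ∧ E.canonAdj v = u

end InclusionSystem

end

/-! For a normalised unit, `u_r` and `u_s ⊗ u_t` are unit vectors whose inner product across `β` is
`‖u_r‖² = 1`, so `β u_r = u_s ⊗ u_t` exactly (`IsUnit.β_eq`). Hence the tensors `u_t₁ ⊗ ⋯ ⊗ u_tₙ`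
are carried to one another by the maps of the direct system, all of them represent the single vector
`i_T u_T`, and this vector is the lift.

An addit is related to `β` only through the adjoint. The sums `A_c = ∑ᵢ u_t₁ ⊗ ⋯ ⊗ a_tᵢ ⊗ ⋯ ⊗ u_tₙ`
are therefore compatible under the adjoints of the refinement maps (`inner_additTens_refMap`), which
is the compatibility of a functional on the limit: `i_c x ↦ ⟪A_c, x⟫`. By Riesz it comes from a
vector of `𝓔_T` as soon as the norms `‖A_c‖` are bounded over `J_T` (`exists_gen`).

That bound is the analytic core (`norm_additTens_sq_le`). The function `α(t) = ⟪a_t, u_t⟫` is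
additive in `t`, and the cross terms in `‖A_c‖²` are those in the expansion of `|α(T)|²`; what
remains is controlled by the growth condition on `a`, because `t ↦ t + t²` is superadditive.

Conversely, the structure maps of `𝓔` are unitary, so a lift or an addit of `𝓔` factors along every
sequence, and its inner products with the total set of vectors `i_c x` depend only on its
projections to the `E_t` (`IsLift.inner_can`, `IsLift.inner_can_addit`). This gives uniqueness of
the lift and injectivity on addits. -/

section

/-! ### Inner products of elementary tensors. -/

variable {A B C : Type*}
  [NormedAddCommGroup A] [InnerProductSpace ℂ A]
  [NormedAddCommGroup B] [InnerProductSpace ℂ B]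
  [NormedAddCommGroup C] [InnerProductSpace ℂ C]

theorem inner_htmul_htmul (x x' : A) (y y' : B) :
    ⟪htmul x y, htmul x' y'⟫_ℂ = ⟪x, x'⟫_ℂ * ⟪y, y'⟫_ℂ :=
  innerMul_htmul x x' y y'

theorem norm_htmul (x : A) (y : B) : ‖htmul x y‖ = ‖x‖ * ‖y‖ :=
  innerMul_htmul.norm x y

/-- If `x` and `y` have norm `1` and `⟪f x, y⟫ = 1`, then `f x = y`. -/
theorem LinearIsometry.eq_of_inner_eq_one (f : A →ₗᵢ[ℂ] B) {x : A} {y : B} (hx : ‖x‖ = 1)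
    (hy : ‖y‖ = 1) (h : ⟪f x, y⟫_ℂ = 1) : f x = y :=
  (inner_eq_one_iff_of_norm_eq_one (𝕜 := ℂ) ((f.norm_map x).trans hx) hy).1 h

/-- An adjoint relation for `f` passes to `I ⊗ f`. -/
theorem inner_hmap_id_htmul {f : B →ₗᵢ[ℂ] C} {b : B} {c : C} (h : ∀ y, ⟪c, f y⟫_ℂ = ⟪b, y⟫_ℂ)
    (p : A) (z : HTensor A B) :
    ⟪htmul p c, hmap .id f z⟫_ℂ = ⟪htmul p b, z⟫_ℂ := by
  refine DFunLike.congr_fun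
    (f := (innerSL ℂ (htmul p c)).comp (hmap .id f).toContinuousLinearMap)
    (g := innerSL ℂ (htmul p b)) (htensor_ext fun x y => ?_) z
  simp [inner_htmul_htmul, h]

end

/-! ### Adjoints of the structure maps and of the canonical maps. -/

namespace InclusionSystem

variable {E : InclusionSystem.{w}}

theorem inner_βadj {s t r : PosReal} (h : s + t = r) (z : HTensor (E.fib s) (E.fib t))
    (x : E.fib r) : ⟪E.βadj h z, x⟫_ℂ = ⟪z, E.β h x⟫_ℂ :=
  ContinuousLinearMap.adjoint_inner_left _ _ _

theorem βadj_β {s t r : PosReal} (h : s + t = r) (x : E.fib r) : E.βadj h (E.β h x) = x :=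
  ext_inner_right ℂ fun y => by rw [inner_βadj, LinearIsometry.inner_map_map]

theorem inner_canonAdj (b : E.generated.Sec) (t : PosReal) (x : E.fib t) :
    ⟪E.canonAdj b t, x⟫_ℂ = ⟪b t, E.canon t x⟫_ℂ :=
  ContinuousLinearMap.adjoint_inner_left _ _ _

theorem norm_canonAdj_le (b : E.generated.Sec) (t : PosReal) : ‖E.canonAdj b t‖ ≤ ‖b t‖ := by
  refine (ContinuousLinearMap.le_opNorm _ _).trans (mul_le_of_le_one_left (norm_nonneg _) ?_)
  rw [LinearIsometryEquiv.norm_map]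
  exact (E.canon t).norm_toContinuousLinearMap_le

/-- The structure maps of a normalised unit are attained without taking adjoints. -/
theorem IsUnit.β_eq {u : E.Sec} (hu : IsUnit u) (hn : IsNormalised u) {s t r : PosReal}
    (h : s + t = r) : E.β h (u r) = htmul (u s) (u t) := by
  -- The equality case of Cauchy–Schwarz: the unit equation turns the inner product of these two
  -- unit vectors into `‖u r‖ ^ 2`.
  refine (E.β h).eq_of_inner_eq_one (hn r) (by rw [norm_htmul, hn, hn, _root_.mul_one]) ?_
  rw [← inner_conj_symm, ← inner_βadj, ← hu.mul h, inner_self_eq_norm_sq_to_K, hn r]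
  simp

/-! ### Units and addits along sequences -/

/-- The tensor `u_t₁ ⊗ ⋯ ⊗ u_tₙ`. -/
noncomputable def unitTens (u : E.Sec) : (c : PosSeq) → E.Tens c
  | .one t => (E.oneIso t).symm (u t)
  | .cons t c => (E.consIso t c).symm (htmul (u t) (unitTens u c))

/-- The sum over `i` of the tensors `u_t₁ ⊗ ⋯ ⊗ a_tᵢ ⊗ ⋯ ⊗ u_tₙ`. -/
noncomputable def additTens (u a : E.Sec) : (c : PosSeq) → E.Tens c
  | .one t => (E.oneIso t).symm (a t)
  | .cons t c => (E.consIso t c).symm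
      (htmul (a t) (unitTens u c) + htmul (u t) (additTens u a c))

theorem norm_unitTens {u : E.Sec} (hn : IsNormalised u) : (c : PosSeq) → ‖unitTens u c‖ = 1
  | .one t => by rw [unitTens, LinearIsometryEquiv.norm_map, hn]
  | .cons t c => by
    rw [unitTens, LinearIsometryEquiv.norm_map, norm_htmul, hn, norm_unitTens hn c, _root_.mul_one]

/-- Splitting an entry replaces `u_r` by `u_s ⊗ u_t`, by `IsUnit.β_eq`. This strong compatibility,
without adjoints, is what normalisation provides. -/
theorem refMap_unitTens {u : E.Sec} (hu : IsUnit u) (hn : IsNormalised u) :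
    {c d : PosSeq} → (r : Ref c d) → E.refMap r (unitTens u c) = unitTens u d
  | _, _, .refl _ => rfl
  | _, _, .keep t r => by
    simp only [refMap_keep, unitTens, LinearIsometryEquiv.apply_symm_apply, hmap_htmul,
      refMap_unitTens hu hn r, LinearIsometry.id_apply]
  | _, _, .splitOne e r => by
    have := refMap_unitTens hu hn r
    rw [unitTens] at this
    simp only [refMap_splitOne, unitTens, LinearIsometryEquiv.apply_symm_apply, hu.β_eq hn,
      hmap_htmul, LinearIsometry.id_apply]
    exact congrArg (fun z => (E.consIso _ _).symm (htmul (u _) z)) this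
  | _, _, .splitCons e r => by
    have := refMap_unitTens hu hn r
    rw [unitTens] at this
    simp only [refMap_splitCons, unitTens, LinearIsometryEquiv.apply_symm_apply, hu.β_eq hn,
      hmap_htmul, hassoc_htmul, LinearIsometry.id_apply]
    exact congrArg (fun z => (E.consIso _ _).symm (htmul (u _) z)) this

theorem inner_unitTens_refMap {u : E.Sec} (hu : IsUnit u) (hn : IsNormalised u) {c d : PosSeq}
    (r : Ref c d) (x : E.Tens c) : ⟪unitTens u d, E.refMap r x⟫_ℂ = ⟪unitTens u c, x⟫_ℂ := by
  rw [← refMap_unitTens hu hn r, LinearIsometry.inner_map_map]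

/-- Only weak compatibility can be expected, since `β a_r` may differ from `a_s ⊗ u_t + u_s ⊗ a_t`
by a vector orthogonal to the range of `β`. Tested against that range the difference disappears, and
induction over the refinement spreads this to all sequences. -/
theorem inner_additTens_refMap {u a : E.Sec} (hu : IsUnit u) (hn : IsNormalised u)
    (ha : IsAddit u a) : {c d : PosSeq} → (r : Ref c d) → (x : E.Tens c) →
    ⟪additTens u a d, E.refMap r x⟫_ℂ = ⟪additTens u a c, x⟫_ℂ
  | _, _, .refl _, _ => rfl
  | _, _, .keep t (c := c) r, x => by
    obtain ⟨x, rfl⟩ := (E.consIso t c).symm.surjective x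
    simp only [refMap_keep, additTens, LinearIsometryEquiv.apply_symm_apply,
      LinearIsometryEquiv.inner_map_map, inner_add_left,
      inner_hmap_id_htmul (inner_unitTens_refMap hu hn r),
      inner_hmap_id_htmul (inner_additTens_refMap hu hn ha r)]
  | _, _, .splitOne (t := t) (r := q) e r, x => by
    have h₁ : ∀ y, ⟪unitTens u _, (E.refMap r).comp (E.oneIso t).symm.toLinearIsometry y⟫_ℂ =
        ⟪u t, y⟫_ℂ := inner_unitTens_refMap hu hn r
    have h₂ : ∀ y, ⟪additTens u a _, (E.refMap r).comp (E.oneIso t).symm.toLinearIsometry y⟫_ℂ =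
        ⟪a t, y⟫_ℂ := inner_additTens_refMap hu hn ha r
    obtain ⟨x, rfl⟩ := (E.oneIso q).symm.surjective x
    simp only [refMap_splitOne, additTens, LinearIsometryEquiv.apply_symm_apply,
      LinearIsometryEquiv.inner_map_map, inner_add_left, inner_hmap_id_htmul h₁,
      inner_hmap_id_htmul h₂]
    rw [← inner_add_left, ← inner_βadj, ← ha.add e]
  | _, _, .splitCons (s := s) (t := t) (r := q) (c := c) (d := d) e r, x => by
    have h₁ : ∀ y, ⟪unitTens u d, (E.refMap r).comp (E.consIso t c).symm.toLinearIsometry y⟫_ℂ =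
        ⟪htmul (u t) (unitTens u c), y⟫_ℂ := inner_unitTens_refMap hu hn r
    have h₂ : ∀ y, ⟪additTens u a d, (E.refMap r).comp (E.consIso t c).symm.toLinearIsometry y⟫_ℂ =
        ⟪htmul (a t) (unitTens u c) + htmul (u t) (additTens u a c), y⟫_ℂ :=
      inner_additTens_refMap hu hn ha r
    obtain ⟨x, rfl⟩ := (E.consIso q c).symm.surjective x
    simp only [refMap_splitCons, additTens, LinearIsometryEquiv.apply_symm_apply,
      LinearIsometryEquiv.inner_map_map, inner_add_left, inner_hmap_id_htmul h₁,
      inner_hmap_id_htmul h₂, map_add]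
    -- Rebracketing the left-hand tensors puts the associator on both sides of each inner product,
    -- where it cancels.
    simp only [← hassoc_htmul, LinearIsometry.inner_map_map]
    -- Both sides are continuous and linear in `x`, so elementary tensors suffice. On them the first
    -- two terms combine to `a q` by the addit equation, and the third gives `u q` by the unit
    -- equation.
    refine DFunLike.congr_fun
      (f := (innerSL ℂ (htmul (htmul (a s) (u t)) (unitTens u c)) +
        (innerSL ℂ (htmul (htmul (u s) (a t)) (unitTens u c)) +
        innerSL ℂ (htmul (htmul (u s) (u t)) (additTens u a c)))).comp
        (hmap (E.β e) .id).toContinuousLinearMap)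
      (g := innerSL ℂ (htmul (a q) (unitTens u c)) + innerSL ℂ (htmul (u q) (additTens u a c)))
      (htensor_ext fun y z => ?_) x
    have h₃ : ⟪a q, y⟫_ℂ = ⟪htmul (a s) (u t), E.β e y⟫_ℂ + ⟪htmul (u s) (a t), E.β e y⟫_ℂ := by
      rw [← inner_add_left, ← inner_βadj, ← ha.add e]
    have h₄ : ⟪u q, y⟫_ℂ = ⟪htmul (u s) (u t), E.β e y⟫_ℂ := by
      rw [← inner_βadj, ← hu.mul e]
    simp [inner_htmul_htmul, h₃, h₄]
    ring

/-- Since `β u_r = u_s ⊗ u_t`, the adjoint can be moved onto `u_r`, and the factors `⟪u, u⟫` equal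
`1`. No regularity in `t` is needed: additivity alone handles the cross terms in
`norm_additTens_sq_le`. -/
theorem inner_unit_addit {u a : E.Sec} (hu : IsUnit u) (hn : IsNormalised u) (ha : IsAddit u a)
    {s t r : PosReal} (h : s + t = r) : ⟪a r, u r⟫_ℂ = ⟪a s, u s⟫_ℂ + ⟪a t, u t⟫_ℂ := by
  rw [ha.add h, inner_βadj, hu.β_eq hn h, inner_add_left, inner_htmul_htmul, inner_htmul_htmul]
  simp [inner_self_eq_norm_sq_to_K, hn s, hn t]

/-- The unit tensor along `c` is the image of the one along the one-term sequence, so weak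
compatibility of the addit tensors reduces the computation to that sequence. -/
theorem inner_additTens_unitTens {u a : E.Sec} (hu : IsUnit u) (hn : IsNormalised u)
    (ha : IsAddit u a) (c : PosSeq) :
    ⟪additTens u a c, unitTens u c⟫_ℂ = ⟪a c.total, u c.total⟫_ℂ := by
  have r := (Ref.nonempty_one c _ rfl).some
  rw [← refMap_unitTens hu hn r, inner_additTens_refMap hu hn ha]
  rfl

/-- Write `α(t) = ⟪a t, u t⟫`. Prepending `t` to `c` adds `‖a t‖ ^ 2` and the cross term `2 Re (α(t)
* conj α(c.total))`. The cross term is part of `|α(t) + α(c.total)|²`, which is `|α|²` at the new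
total, so it does not accumulate with the number of entries. Carrying `|α|²` in the statement is
what makes the induction close. -/
theorem norm_additTens_sq_le {u a : E.Sec} (hu : IsUnit u) (hn : IsNormalised u)
    (ha : IsAddit u a) {k : ℝ} (hk : 0 ≤ k)
    (hb : ∀ t : PosReal, ‖a t‖ ^ 2 ≤ k * (t + (t : ℝ) ^ 2)) :
    (c : PosSeq) → ‖additTens u a c‖ ^ 2 ≤
      ‖⟪a c.total, u c.total⟫_ℂ‖ ^ 2 + k * (c.total + (c.total : ℝ) ^ 2)
  | .one t => by
    rw [additTens, LinearIsometryEquiv.norm_map]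
    exact (hb t).trans (le_add_of_nonneg_left (by positivity))
  | .cons t c => by
    have ih := norm_additTens_sq_le hu hn ha hk hb c
    have h₁ : ⟪a (t + c.total), u (t + c.total)⟫_ℂ = _ := inner_unit_addit hu hn ha rfl
    have h₂ := inner_additTens_unitTens hu hn ha c
    have h₃ : ((t + c.total : PosReal) : ℝ) = t + c.total := rfl
    rw [additTens, LinearIsometryEquiv.norm_map, PosSeq.total, h₁, h₃,
      @norm_add_sq ℂ, inner_htmul_htmul, norm_htmul, norm_htmul, hn t, norm_unitTens hn c,
      ← inner_conj_symm (unitTens u c), h₂, @norm_add_sq ℂ]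
    have h₄ : RCLike.re (⟪a t, u t⟫_ℂ * (starRingEnd ℂ) ⟪a c.total, u c.total⟫_ℂ) =
        RCLike.re ⟪⟪a t, u t⟫_ℂ, ⟪a c.total, u c.total⟫_ℂ⟫_ℂ := by
      rw [RCLike.inner_apply, ← RCLike.conj_re, map_mul, RCLike.conj_conj, mul_comm]
    rw [h₄]
    have h₅ := hb t
    -- Twice this is the amount by which `k (t + c.total)²` exceeds `k t² + k c.total²`.
    have h₆ : 0 ≤ k * (t * c.total) := mul_nonneg hk (mul_pos t.2 c.total.2).le
    have h₇ : 0 ≤ ‖⟪a t, u t⟫_ℂ‖ ^ 2 := by positivity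
    nlinarith

/-- Cauchy–Schwarz with `‖u‖ = 1` bounds `|α|²` by a second copy of `k (T + T²)`, whence the factor
`2`. The result depends only on the total, so it is uniform over `J_T`. -/
theorem norm_additTens_le {u a : E.Sec} (hu : IsUnit u) (hn : IsNormalised u)
    (ha : IsAddit u a) {k : ℝ} (hk : 0 ≤ k)
    (hb : ∀ t : PosReal, ‖a t‖ ^ 2 ≤ k * (t + (t : ℝ) ^ 2)) (c : PosSeq) :
    ‖additTens u a c‖ ≤ √(2 * k * (c.total + (c.total : ℝ) ^ 2)) := by
  refine Real.le_sqrt_of_sq_le ((norm_additTens_sq_le hu hn ha hk hb c).trans ?_)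
  have h₁ : ‖⟪a c.total, u c.total⟫_ℂ‖ ≤ ‖a c.total‖ := by
    simpa [hn c.total] using norm_inner_le_norm (𝕜 := ℂ) (a c.total) (u c.total)
  have h₂ := (pow_le_pow_left₀ (norm_nonneg _) h₁ 2).trans (hb c.total)
  linarith

/-! ### Unit and addit tensors of a concatenation. -/

theorem join_cons_consIso_symm (t : PosReal) (c d : PosSeq) (p : E.fib t) (q : E.Tens c)
    (y : E.Tens d) : E.join (.cons t c) d (htmul ((E.consIso t c).symm (htmul p q)) y) =
      (E.consIso t (c.append d)).symm (htmul p (E.join c d (htmul q y))) := by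
  rw [join_cons_htmul, LinearIsometryEquiv.apply_symm_apply, hassoc_htmul, hmap_htmul]
  rfl

theorem join_unitTens (u : E.Sec) (d : PosSeq) : (c : PosSeq) →
    E.join c d (htmul (unitTens u c) (unitTens u d)) = unitTens u (c.append d)
  | .one t => by rw [join_one_htmul]; rfl
  | .cons t c => (join_cons_consIso_symm t c d _ _ _).trans <|
      congrArg (fun z => (E.consIso t (c.append d)).symm (htmul (u t) z)) (join_unitTens u d c)

/-- A Leibniz rule: in each summand the single factor `a` sits either in `c` or in `d`. In the limit
this becomes the addit equation of the lifted section. -/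
theorem join_additTens (u a : E.Sec) (d : PosSeq) : (c : PosSeq) →
    E.join c d (htmul (additTens u a c) (unitTens u d)) +
      E.join c d (htmul (unitTens u c) (additTens u a d)) = additTens u a (c.append d)
  | .one t => by
    rw [join_one_htmul, join_one_htmul]
    exact (map_add (E.consIso t d).symm _ _).symm
  | .cons t c => by
    simp only [unitTens, additTens, map_add, add_apply, add_assoc]
    rw [join_cons_consIso_symm, join_cons_consIso_symm, join_cons_consIso_symm, join_unitTens]
    -- The summand with `a` in the head entry is already the same on both sides; the induction
    -- hypothesis is applied to the tails behind `u t`.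
    refine congrArg (fun z : E.Tens (.cons t (c.append d)) => (E.consIso t (c.append d)).symm
      (htmul (a t) (unitTens u (c.append d))) + z) ?_ |>.trans
      (map_add (E.consIso t (c.append d)).symm _ _).symm
    refine (map_add (E.consIso t (c.append d)).symm _ _).symm.trans
      (congrArg (E.consIso t (c.append d)).symm ?_)
    rw [← map_add, join_additTens u a d c]

/-! ### Vectors of the inductive limit -/

theorem gen_ext_inner {T : PosReal} {v w : E.Gen T}
    (h : ∀ c hc x, ⟪v, E.can c hc x⟫_ℂ = ⟪w, E.can c hc x⟫_ℂ) : v = w :=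
  ext_inner_right ℂ fun x =>
    DFunLike.congr_fun (E.gen_ext (f := innerSL ℂ v) (g := innerSL ℂ w) h) x

/-- A bounded family of vectors which is compatible with the adjoints of the maps of the system
comes from a vector of the inductive limit. -/
theorem exists_gen {T : PosReal} (y : ∀ c, E.Tens c)
    (hy : ∀ {c d} (r : Ref c d) x, ⟪y d, E.refMap r x⟫_ℂ = ⟪y c, x⟫_ℂ) {K : ℝ}
    (hK : ∀ c, c.total = T → ‖y c‖ ≤ K) :
    ∃ w : E.Gen T, ‖w‖ ≤ K ∧ ∀ c hc x, ⟪w, E.can c hc x⟫_ℂ = ⟪y c, x⟫_ℂ := by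
  have hK0 : 0 ≤ K := (norm_nonneg _).trans (hK (.one T) rfl)
  -- The functional `i_c x ↦ ⟪y c, x⟫`; compatibility under adjoints is exactly its well-definedness
  -- on the algebraic limit.
  let l₀ : PreLim (E.sys T) →ₗ[ℂ] ℂ := DirectLimit.Module.lift ℂ (Subdiv T) _ (E.sys T)
    (fun c => (innerSL ℂ (y c.1)).toLinearMap) (fun c d r x => hy r.some x)
  have hl₀ : ∀ (c : Subdiv T) (x : E.Tens c.1), l₀ (preOf (E.sys T) c x) = ⟪y c.1, x⟫_ℂ :=
    fun _ _ => rfl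
  have hb : ∀ z, ‖l₀ z‖ ≤ K * ‖z‖ := fun z => by
    obtain ⟨c, x, rfl⟩ := exists_preOf (E.sys T) z
    have h : ‖preOf (E.sys T) c x‖ = ‖x‖ :=
      ((preOf (E.sys T) c).isometryOfInner (inner_preOf (E.sys T) c)).norm_map x
    rw [hl₀, h]
    exact (norm_inner_le_norm _ _).trans (mul_le_mul_of_nonneg_right (hK c.1 c.2) (norm_nonneg _))
  let l : E.Gen T →L[ℂ] ℂ := (l₀.mkContinuous K hb).fromCompletion
  -- The Riesz representative, whose norm is that of the functional; the bound `K` extends from the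
  -- algebraic limit by density.
  let w : E.Gen T := (InnerProductSpace.toDual ℂ (E.Gen T)).symm l
  have hw : ∀ x, ⟪w, x⟫_ℂ = l x := fun x => InnerProductSpace.toDual_symm_apply
  have hc : ∀ c hc x, ⟪w, E.can c hc x⟫_ℂ = ⟪y c, x⟫_ℂ := fun c hc x => by
    rw [hw]
    exact ContinuousLinearMap.fromCompletion_apply_coe (l₀.mkContinuous K hb)
      (preOf (E.sys T) ⟨c, hc⟩ x)
  refine ⟨w, ?_, hc⟩
  rw [LinearIsometryEquiv.norm_map]
  refine ContinuousLinearMap.opNorm_le_bound _ hK0 fun z => ?_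
  induction z using Completion.induction_on with
  | hp => exact isClosed_le (by fun_prop) (by fun_prop)
  | ih z =>
    change ‖(l₀.mkContinuous K hb).fromCompletion (z : Completion _)‖ ≤
      K * ‖(z : Completion (PreLim (E.sys T)))‖
    rw [ContinuousLinearMap.fromCompletion_apply_coe, Completion.norm_coe]
    exact hb z

end InclusionSystem

namespace InclusionSystem

variable {E : InclusionSystem.{w}}

/-! ### Sections of the generated product system -/

theorem genMul_canon {a S T : PosReal} (h : a + S = T) (e : E.fib a) (y : E.Gen S) :
    E.genMul h (E.canon a e : E.Gen a) y = E.consMul h e y :=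
  E.genMul_can h (.one a) rfl ((E.oneIso a).symm e) y

/-- The structure maps of the generated system are unitary, so their adjoints are the inverses
`genIso`. The unit and addit equations there become honest product formulas. -/
theorem generated_eq_βadj_iff {R S T : PosReal} (h : R + S = T) (x : E.generated.fib T)
    (z : HTensor (E.Gen R) (E.Gen S)) : x = E.generated.βadj h z ↔ x = E.genIso h z := by
  obtain ⟨y, rfl⟩ := (E.genB h).surjective z
  have h₁ : E.generated.βadj h (E.genB h y) = y := βadj_β (E := E.generated) h y
  have h₂ : E.genIso h (E.genB h y) = y := (LinearIsometryEquiv.ofSurjective (E.genIso h)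
    (E.genIso_surjective h)).apply_symm_apply y
  rw [h₁, h₂]

theorem inner_genMul {R S T : PosReal} (h : R + S = T) (x x' : E.Gen R) (y y' : E.Gen S) :
    ⟪E.genMul h x y, E.genMul h x' y'⟫_ℂ = ⟪x, x'⟫_ℂ * ⟪y, y'⟫_ℂ :=
  E.innerMul_genMul h x x' y y'

theorem IsUnit.generated_eq {v : E.generated.Sec} (hv : IsUnit v) {R S T : PosReal}
    (h : R + S = T) : v T = E.genMul h (v R) (v S) :=
  ((generated_eq_βadj_iff h _ _).1 (hv.mul h)).trans (E.genIso_htmul h _ _)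

theorem IsAddit.generated_eq {v b : E.generated.Sec} (hb : IsAddit v b) {R S T : PosReal}
    (h : R + S = T) : b T = E.genMul h (b R) (v S) + E.genMul h (v R) (b S) := by
  refine ((generated_eq_βadj_iff h _ _).1 (hb.add h)).trans ?_
  exact (map_add (E.genIso h) _ _).trans
    (congrArg₂ (· + ·) (E.genIso_htmul h _ _) (E.genIso_htmul h _ _))

/-- A functional on the image of `E_(a ⌣ c)` is determined by its values on products. -/
theorem gen_ext_cons {a S T : PosReal} (h : a + S = T) {c : PosSeq} (hc : c.total = S)
    {w : E.Gen T} {z : E.Tens (.cons a c)}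
    (H : ∀ e x, ⟪w, E.genMul h (E.canon a e : E.Gen a) (E.can c hc x)⟫_ℂ =
      ⟪z, (E.consIso a c).symm (htmul e x)⟫_ℂ) (x : E.Tens (.cons a c)) :
    ⟪w, E.can (.cons a c) (PosSeq.total_cons h hc) x⟫_ℂ = ⟪z, x⟫_ℂ := by
  obtain ⟨x, rfl⟩ := (E.consIso a c).symm.surjective x
  refine DFunLike.congr_fun
    (f := (innerSL ℂ w).comp ((E.can (.cons a c) (PosSeq.total_cons h hc)).comp
      (E.consIso a c).symm.toLinearIsometry).toContinuousLinearMap)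
    (g := (innerSL ℂ z).comp (E.consIso a c).symm.toLinearIsometry.toContinuousLinearMap)
    (htensor_ext fun p q => ?_) x
  have := H p q
  rw [genMul_canon, consMul_can] at this
  exact this

/-- Along any sequence `v` factors as a product of its values at the entries, and the value at `t`
pairs with vectors from `E_t` as `u t` does. Hence `u` determines all inner products of `v` with a
total set. -/
theorem IsLift.inner_can {u : E.Sec} {v : E.generated.Sec} (hv : IsLift u v) :
    (c : PosSeq) → {T : PosReal} → (hc : c.total = T) → (x : E.Tens c) →
    ⟪v T, E.can c hc x⟫_ℂ = ⟪unitTens u c, x⟫_ℂ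
  | .one t, T, hc, x => by
    obtain rfl : t = T := hc
    obtain ⟨x, rfl⟩ := (E.oneIso t).symm.surjective x
    rw [unitTens, LinearIsometryEquiv.inner_map_map, ← hv.2, inner_canonAdj]
    rfl
  | .cons t c, T, hc, x => by
    refine gen_ext_cons (S := c.total) hc rfl (fun e x => ?_) x
    rw [hv.1.generated_eq (show t + c.total = T from hc)]
    refine (inner_genMul (E := E) _ _ _ _ _).trans ?_
    rw [unitTens, LinearIsometryEquiv.inner_map_map, inner_htmul_htmul, ← hv.inner_can c rfl,
      ← congrFun hv.2 t, inner_canonAdj]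
    rfl

/-- The same induction with the product rule for `b`: every term involves only the projections of
`b` and `v` to the fibres of `E`. -/
theorem IsLift.inner_can_addit {u : E.Sec} {v b : E.generated.Sec} (hv : IsLift u v)
    (hb : IsAddit v b) : (c : PosSeq) → {T : PosReal} → (hc : c.total = T) → (x : E.Tens c) →
    ⟪b T, E.can c hc x⟫_ℂ = ⟪additTens u (E.canonAdj b) c, x⟫_ℂ
  | .one t, T, hc, x => by
    obtain rfl : t = T := hc
    obtain ⟨x, rfl⟩ := (E.oneIso t).symm.surjective x
    rw [additTens, LinearIsometryEquiv.inner_map_map, inner_canonAdj]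
    rfl
  | .cons t c, T, hc, x => by
    refine gen_ext_cons (S := c.total) hc rfl (fun e x => ?_) x
    rw [hb.generated_eq (show t + c.total = T from hc)]
    refine (inner_add_left (E := E.Gen T) _ _ _).trans ?_
    refine (congrArg₂ (· + ·) (inner_genMul (E := E) _ _ _ _ _)
      (inner_genMul (E := E) _ _ _ _ _)).trans ?_
    rw [additTens, LinearIsometryEquiv.inner_map_map, inner_add_left, inner_htmul_htmul,
      inner_htmul_htmul, ← hv.inner_can c rfl, ← hv.inner_can_addit hb c rfl, ← congrFun hv.2 t,
      inner_canonAdj, inner_canonAdj]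
    rfl

/-! ### Existence and uniqueness of the lift. -/

/-- The lift of a normalised unit. -/
noncomputable def lift (u : E.Sec) : E.generated.Sec := fun t => E.canon t (u t)

/-- Strong compatibility of the unit tensors makes all of them one vector of the limit, so the lift
may be computed along whichever sequence is convenient. -/
theorem can_unitTens {u : E.Sec} (hu : IsUnit u) (hn : IsNormalised u) {T : PosReal} (c : PosSeq)
    (hc : c.total = T) : E.can c hc (unitTens u c) = lift u T := by
  rw [← refMap_unitTens hu hn (Ref.nonempty_one c T hc).some]
  exact can_refMap E (Ref.nonempty_one c T hc).some
    (show (PosSeq.one T).total = T from rfl) hc _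

theorem isNormalised_lift {u : E.Sec} (hn : IsNormalised u) : IsNormalised (lift u) :=
  fun t => ((E.canon t).norm_map _).trans (hn t)

theorem canonAdj_lift (u : E.Sec) : E.canonAdj (lift u) = u :=
  funext fun t => ext_inner_right ℂ fun x => by
    rw [inner_canonAdj, lift, LinearIsometry.inner_map_map]

theorem isLift_lift {u : E.Sec} (hu : IsUnit u) (hn : IsNormalised u) : IsLift u (lift u) := by
  refine ⟨⟨fun h => ?_, ⟨0, fun t => ?_⟩, fun {s t r} h => ?_⟩, canonAdj_lift u⟩
  · have := isNormalised_lift hn ⟨1, one_pos⟩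
    rw [h, Pi.zero_apply, norm_zero] at this
    exact zero_ne_one this
  · rw [isNormalised_lift hn t]
    simp
  · refine (generated_eq_βadj_iff h _ _).2 ?_
    refine Eq.trans ?_ (E.genIso_htmul h _ _).symm
    -- Along `(s, t)` the lift is visibly the product of its values at `s` and `t`.
    rw [← can_unitTens hu hn (.cons s (.one t)) h]
    exact ((genMul_canon h (u s) (E.can (.one t) rfl _)).trans (E.consMul_can h _ _ rfl _)).symm

theorem IsLift.eq {u : E.Sec} {v v' : E.generated.Sec} (hv : IsLift u v) (hv' : IsLift u v') :
    v = v' :=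
  funext fun _ => gen_ext_inner (E := E) fun c hc x =>
    (hv.inner_can c hc x).trans (hv'.inner_can c hc x).symm

/-! ### The correspondence of addits. -/

/-- In the limit `i_r x` equals the image of `β x` along `(s, t)`, and pairing `b` with the latter
gives the two-entry addit tensor of the projections. The growth bound survives because the adjoint
of an isometry is a contraction. -/
theorem IsLift.isAddit_canonAdj {u : E.Sec} {v b : E.generated.Sec} (hv : IsLift u v)
    (hb : IsAddit v b) : IsAddit u (E.canonAdj b) where
  add {s t r} h := ext_inner_right ℂ fun x => by
    let ρ : Ref (.one r) (.cons s (.one t)) := .splitOne h (.refl t)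
    have hd : (PosSeq.cons s (.one t)).total = r := h
    have h₁ := hv.inner_can_addit hb (.cons s (.one t)) hd (E.refMap ρ ((E.oneIso r).symm x))
    have h₂ : E.refMap ρ ((E.oneIso r).symm x) = (E.consIso s (.one t)).symm (E.β h x) :=
      congrArg (E.consIso s (.one t)).symm (hmap_id _)
    rw [h₂] at h₁
    rw [inner_canonAdj, inner_βadj]
    refine (congrArg (fun y : E.Gen r => ⟪b r, y⟫_ℂ) (E.can_refMap ρ
      (show (PosSeq.one r).total = r from rfl) hd ((E.oneIso r).symm x)).symm).trans ?_
    rw [h₂]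
    exact h₁.trans ((E.consIso s (.one t)).symm.inner_map_map _ _)
  bound := by
    obtain ⟨k, hk, hb⟩ := hb.bound
    exact ⟨k, hk, fun t =>
      (pow_le_pow_left₀ (norm_nonneg _) (norm_canonAdj_le b t) 2).trans (hb t)⟩

theorem IsLift.injOn {u : E.Sec} {v : E.generated.Sec} (hv : IsLift u v) :
    Set.InjOn E.canonAdj {b : E.generated.Sec | IsAddit v b} := fun b hb b' hb' h =>
  funext fun _ => gen_ext_inner (E := E) fun c hc x => by
    refine (hv.inner_can_addit hb c hc x).trans ?_
    rw [h]
    exact (hv.inner_can_addit hb' c hc x).symm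

/-- Products of canonical vectors are total in the tensor product and `genIso` is onto, so testing
on them suffices. It reduces the addit equation for a lifted section to an identity of finite
tensors. -/
theorem genIso_ext_inner {R S T : PosReal} (h : R + S = T) {w : E.Gen T}
    {z : HTensor (E.Gen R) (E.Gen S)}
    (H : ∀ c d hc hd x y, ⟪w, E.genMul h (E.can c hc x) (E.can d hd y)⟫_ℂ =
      ⟪z, htmul (E.can c hc x) (E.can d hd y)⟫_ℂ) : w = E.genIso h z := by
  refine ext_inner_right ℂ fun y => ?_
  obtain ⟨y, rfl⟩ := E.genIso_surjective h y
  rw [LinearIsometry.inner_map_map]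
  refine DFunLike.congr_fun (f := (innerSL ℂ w).comp (E.genIso h).toContinuousLinearMap)
    (g := innerSL ℂ z) (htensor_ext fun p q => ?_) y
  refine (congrArg (fun y => ⟪w, y⟫_ℂ) (E.genIso_htmul h p q)).trans ?_
  refine DFunLike.congr_fun (f := (innerSL ℂ w).comp (E.genMul h p))
    (g := (innerSL ℂ z).comp (htmul p)) (E.gen_ext fun d hd y => ?_) q
  refine DFunLike.congr_fun
    (f := (innerSL ℂ w).comp ((E.genMul h).flip (E.can d hd y)))
    (g := (innerSL ℂ z).comp (htmul.flip (E.can d hd y))) (E.gen_ext fun c hc x => ?_) p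
  exact H c d hc hd x y

/-- `exists_gen` applied to the addit tensors supplies the vectors. Their addit equation is the
Leibniz rule `join_additTens`, and their projections are read off on one-term sequences. -/
theorem IsLift.exists_addit {u a : E.Sec} {v : E.generated.Sec} (hu : IsUnit u)
    (hn : IsNormalised u) (hv : IsLift u v) (ha : IsAddit u a) :
    ∃ b : E.generated.Sec, IsAddit v b ∧ E.canonAdj b = a := by
  obtain ⟨k, hk, hb⟩ := ha.bound
  have hex (T : PosReal) := exists_gen (T := T) (additTens u a)
    (inner_additTens_refMap hu hn ha) (K := √(2 * k * (T + (T : ℝ) ^ 2)))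
    (fun c hc => hc ▸ norm_additTens_le hu hn ha hk hb c)
  choose b hbK hbc using hex
  -- The growth constant doubles to `2 * k`, as in the uniform bound of `norm_additTens_le`.
  refine ⟨b, ⟨fun {R S T} h => (generated_eq_βadj_iff h _ _).2 ?_, 2 * k, by positivity,
    fun t => ?_⟩, funext fun t => ext_inner_right ℂ fun x => ?_⟩
  · refine genIso_ext_inner h fun c d hc hd x y => ?_
    have hcd : (c.append d).total = T := by rw [PosSeq.total_append, hc, hd, h]
    rw [genMul_can, E.mul_can c d _ hd hcd, hbc, ← join_additTens, inner_add_left,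
      LinearIsometry.inner_map_map, LinearIsometry.inner_map_map]
    refine Eq.trans ?_ (inner_add_left (E := HTensor (E.Gen R) (E.Gen S)) _ _ _).symm
    refine Eq.trans ?_ (congrArg₂ (· + ·) (inner_htmul_htmul (A := E.Gen R) (B := E.Gen S) _ _ _ _)
      (inner_htmul_htmul (A := E.Gen R) (B := E.Gen S) _ _ _ _)).symm
    rw [inner_htmul_htmul, inner_htmul_htmul]
    exact congrArg₂ (· + ·)
      (congrArg₂ (· * ·) (hbc R c hc x).symm (hv.inner_can d hd y).symm)
      (congrArg₂ (· * ·) (hv.inner_can c hc x).symm (hbc S d hd y).symm)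
  · exact (Real.le_sqrt (norm_nonneg _) (mul_nonneg (by positivity)
      (add_nonneg t.2.le (sq_nonneg _)))).1 (hbK t)
  · refine (inner_canonAdj (E := E) b t x).trans ?_
    exact hbc t (.one t) rfl ((E.oneIso t).symm x)

/-- The lifted unit at `t` lies in the range of `i_t`, so its inner product with `b t` sees only the
projection of `b t` to `E_t`, which is `a t`. -/
theorem isRoot_of_canonAdj {u a : E.Sec} {b : E.generated.Sec} (ha : IsRoot u a)
    (hb : IsAddit (lift u) b) (h : E.canonAdj b = a) : IsRoot (lift u) b where
  toIsAddit := hb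
  orthogonal t := by
    rw [lift, ← inner_canonAdj, h]
    exact ha.orthogonal t

end InclusionSystem

/-- Let `u` be a normalised unit of the inclusion system `E`. Then `u` has exactly one lift `v` to
the generated product system, `v` is normalised, the adjoints of the canonical maps restrict to a
bijection from the addits of `(E.generated, v)` onto the addits of `(E, u)`, and the addit which
corresponds to a root of `(E, u)` is a root of `(E.generated, v)`. -/
theorem proposition3p12 (E : InclusionSystem.{w}) (u : E.Sec)
    (hu : InclusionSystem.IsUnit u) (hn : InclusionSystem.IsNormalised u) :
    (∃! v : E.generated.Sec, InclusionSystem.IsLift u v) ∧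
    ∀ v : E.generated.Sec, InclusionSystem.IsLift u v →
      InclusionSystem.IsNormalised v ∧
      Set.BijOn E.canonAdj
        {b : E.generated.Sec | InclusionSystem.IsAddit v b}
        {a : E.Sec | InclusionSystem.IsAddit u a} ∧
      ∀ (a : E.Sec) (b : E.generated.Sec), InclusionSystem.IsRoot u a →
        InclusionSystem.IsAddit v b → E.canonAdj b = a → InclusionSystem.IsRoot v b := by
  have hl := InclusionSystem.isLift_lift hu hn
  refine ⟨⟨_, hl, fun v hv => hv.eq hl⟩, fun v hv => ?_⟩
  -- By uniqueness an arbitrary lift may be replaced by the explicit `lift u`.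
  obtain rfl := hv.eq hl
  exact ⟨InclusionSystem.isNormalised_lift hn,
    ⟨fun b hb => hl.isAddit_canonAdj hb, hl.injOn, fun a ha => hl.exists_addit hu hn ha⟩,
    fun a b ha hb h => InclusionSystem.isRoot_of_canonAdj ha hb h⟩
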